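/- **Setting.** Let $P$ be a finite poset that is $(\mathbf 3+\mathbf 1)$-free, i.e. there are no $a<_Pb<_Pc$ and $x\in P$ with $x$ incomparable to each of $a,b,c$. Let $\Lambda(\mathbf x)$ be the ring of symmetric functions over $\mathbb Z$ in $\mathbf x=(x_1,x_2,\dots)$, with elementary and monomial symmetric functions $e_k$, $e_\nu=\prod_i e_{\nu_i}$ and $m_\nu$. Let $\mathbb Z[\mathbf u]$ be the polynomial ring in commuting variables $u_p$, $p\in P$, put $\mathbf u_P=\prod_{p\in P}u_p$, and write $\langle\mathbf u_P\rangle g$ for the coefficient of $\mathbf u_P$ in $g\in\mathbb Z[\mathbf u]$. Let $\psi\colon\Lambda(\mathbf x)\to\mathbb Z[\mathbf u]$ be the ring homomorphism with $$\psi(e_k(\mathbf x))=e_k^P(\mathbf u):=\sum_{i_1<_P\cdots<_Pi_k}u_{i_1}\cdots u_{i_k}\qquad(k\ge 0).$$ Let $X_{\mathrm{inc}(P)}(\mathbf x)=\sum_\kappa\prod_{p\in P}x_{\kappa(p)}$ be the chromatic symmetric function of the incomparability graph of $P$; the sum is over its proper colorings $\kappa\colon P\to\mathbb Z_{>0}$.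 Let $\mu\subset\lambda$ be partitions, with transposes $\mu',\lambda'$ and with $l=\lambda_1$ columns in $\lambda$, and let $d\ge 0$ be an integer with $\max(\lambda'_1-\lambda'_l,\ \mu'_1-\mu'_l)\le d\le\lambda'_1$ (for $\lambda=\varnothing$ this means $d=0$). Then $\lambda/\mu/d$ is called a cylindric shape. For a poset $Q$ and $T\colon\lambda/\mu\to Q$, let $T^d$ be the filling obtained by gluing a copy of the first column of $T$, shifted up by $d$ cells, to the right of the last column of $T$; it has shape $\nu/\theta$ with $\nu'=(\lambda_1'+d,\dots,\lambda_l'+d,\lambda_1')$ and $\theta'=(\mu_1'+d,\dots,\mu_l'+d,\mu_1')$. Call $T$ a cylindric $Q$-tableau of shape $\lambda/\mu/d$ if in $T^d$ each entry is $<_Q$ the entry directly below it, and no entry is $>_Q$ the entry directly to its right. A cylindric $P$-tableau is standard if it contains each element of $P$ exactly once. Let $$s_{\lambda/\mu/d}(\mathbf x)=\sum_T\prod_{b\in\lambda/\mu}x_{T(b)},$$ the sum over all cylindric $Q$-tableaux $T$ of shape $\lambda/\mu/d$ for $Q=\mathbb Z_{>0}$ with its usual total order, and let $s^P_{\lambda/\mu/d}(\mathbf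 u)=\psi(s_{\lambda/\mu/d}(\mathbf x))$. **Statement.** The homomorphism $\psi$ exists and is unique, $s_{\lambda/\mu/d}(\mathbf x)\in\Lambda(\mathbf x)$, and there are unique finitely supported families of integers $(a_\nu)$ and $(c^P_\nu)$, indexed by all partitions $\nu$, with $$s_{\lambda/\mu/d}(\mathbf x)=\sum_\nu a_\nu m_\nu(\mathbf x),\qquad X_{\mathrm{inc}(P)}(\mathbf x)=\sum_\nu c^P_\nu e_\nu(\mathbf x).$$ Moreover $$\sum_\nu a_\nu c^P_\nu=\langle\mathbf u_P\rangle\,s^P_{\lambda/\mu/d}(\mathbf u)=\#\{T : T\text{ is a standard cylindric }P\text{-tableau of shape }\lambda/\mu/d\}.$$ In particular $\sum_\nu a_\nu c^P_\nu\ge 0$. -/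

import Mathlib

namespace CylP

noncomputable section

/-! ### Symmetric functions in countably many variables

The variables `x₁, x₂, …` are indexed by `ℕ`, so that the variable with index `i` is `x_{i+1}`. -/

/-- The ring of symmetric functions with integer coefficients: formal power series in the
variables `x_i`, `i ∈ ℕ`, of bounded degree and invariant under all permutations of the
variables. -/
def symFun : Subring (MvPowerSeries ℕ ℤ) where
  carrier := {f | (∀ σ : Equiv.Perm ℕ, MvPowerSeries.renameEquiv ℤ σ f = f) ∧
    ∃ N : ℕ, ∀ m : ℕ →₀ ℕ, N < m.degree → MvPowerSeries.coeff m f = 0}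
  mul_mem' := by
    classical
    rintro f g ⟨hf, N, hN⟩ ⟨hg, M, hM⟩
    refine ⟨fun σ => by rw [map_mul, hf, hg], N + M, fun m hm => ?_⟩
    rw [MvPowerSeries.coeff_mul]
    refine Finset.sum_eq_zero fun p hp => ?_
    rw [Finset.HasAntidiagonal.mem_antidiagonal] at hp
    have h : p.1.degree + p.2.degree = m.degree := by rw [← hp, map_add]
    rcases lt_or_ge N p.1.degree with h1 | h1
    · rw [hN _ h1, zero_mul]
    · rw [hM _ (by omega), mul_zero]
  one_mem' := by
    classical
    refine ⟨fun σ => map_one _, 0, fun m hm => ?_⟩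
    rw [MvPowerSeries.coeff_one, if_neg]
    rintro rfl
    simp at hm
  add_mem' := by
    rintro f g ⟨hf, N, hN⟩ ⟨hg, M, hM⟩
    refine ⟨fun σ => by rw [map_add, hf, hg], N + M, fun m hm => ?_⟩
    rw [map_add, hN _ (by omega), hM _ (by omega), add_zero]
  zero_mem' := ⟨fun σ => map_zero _, 0, fun m _ => map_zero _⟩
  neg_mem' := by
    rintro f ⟨hf, N, hN⟩
    exact ⟨fun σ => by rw [map_neg, hf], N, fun m hm => by rw [map_neg, hN m hm, neg_zero]⟩

open Classical in
/-- The elementary symmetric function `e_k`: the sum of all square-free monomials of degree `k`. -/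
def esymm (k : ℕ) : MvPowerSeries ℕ ℤ :=
  fun m => if (∀ i, m i ≤ 1) ∧ m.degree = k then 1 else 0

theorem esymm_mem (k : ℕ) : esymm k ∈ symFun := by
  classical
  refine ⟨fun σ => ?_, k, fun m hm => ?_⟩
  · ext m
    obtain ⟨m, rfl⟩ : ∃ m', m = Finsupp.embDomain σ.toEmbedding m' :=
      ⟨Finsupp.embDomain σ.symm.toEmbedding m, by
        ext i
        obtain ⟨i, rfl⟩ := σ.surjective i
        have h := Finsupp.embDomain_apply_self σ.toEmbedding
          (Finsupp.embDomain σ.symm.toEmbedding m) i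
        have h2 := Finsupp.embDomain_apply_self σ.symm.toEmbedding m (σ i)
        simp only [Equiv.coe_toEmbedding, Equiv.symm_apply_apply] at h h2
        rw [h, h2]⟩
    have h1 : (∀ i, Finsupp.embDomain σ.toEmbedding m i ≤ 1) ↔ ∀ i, m i ≤ 1 := by
      rw [← σ.forall_congr_right]
      refine forall_congr' fun i => ?_
      have h := Finsupp.embDomain_apply_self σ.toEmbedding m i
      rw [Equiv.coe_toEmbedding] at h
      rw [h]
    have h2 : (Finsupp.embDomain σ.toEmbedding m).degree = m.degree := by
      rw [Finsupp.embDomain_eq_mapDomain, Finsupp.degree_mapDomain]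
    have h3 : MvPowerSeries.coeff (Finsupp.embDomain σ.toEmbedding m)
        (MvPowerSeries.renameEquiv ℤ σ (esymm k)) = MvPowerSeries.coeff m (esymm k) :=
      MvPowerSeries.coeff_embDomain_rename σ.toEmbedding (esymm k) m
    rw [h3]
    simp only [MvPowerSeries.coeff_apply, esymm, h1, h2]
  · rw [MvPowerSeries.coeff_apply, esymm, if_neg]
    rintro ⟨-, h⟩
    omega

/-- Integer partitions of all natural numbers. -/
abbrev Ptn : Type := Σ n : ℕ, Nat.Partition n

/-- `e_ν`, the product of the `e_k` over the parts `k` of `ν`. -/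
def esymmPart (ν : Ptn) : MvPowerSeries ℕ ℤ := (ν.2.parts.map esymm).prod

open Classical in
/-- The monomial symmetric function `m_ν`: the sum of all monomials whose multiset of nonzero
exponents is the multiset of parts of `ν`. -/
def msymm (ν : Ptn) : MvPowerSeries ℕ ℤ :=
  fun m => if m.support.val.map m = ν.2.parts then 1 else 0

/-! ### Posets and chromatic symmetric functions -/

/-- `P` has no induced subposet that is the disjoint union of a three-element chain and a
one-element chain. -/
def ThreePlusOneFree (P : Type*) [PartialOrder P] : Prop :=
  ¬ ∃ a b c x : P, a < b ∧ b < c ∧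
    IncompRel (· ≤ ·) x a ∧ IncompRel (· ≤ ·) x b ∧ IncompRel (· ≤ ·) x c

/-- The incomparability graph of `P`. -/
def incGraph (P : Type*) [PartialOrder P] : SimpleGraph P where
  Adj x y := IncompRel (· ≤ ·) x y
  symm := ⟨fun _ _ h => ⟨h.2, h.1⟩⟩
  loopless := ⟨fun _ h => h.1 le_rfl⟩

/-- The chromatic symmetric function `X_G`: the coefficient of `x^m` is the number of proper
colorings of `G` that use the color `i` exactly `m i` times, for every `i`. -/
def chromaticSymFun {V : Type*} [Fintype V] (G : SimpleGraph V) : MvPowerSeries ℕ ℤ :=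
  fun m => (Nat.card {κ : G.Coloring ℕ // ∑ v, Finsupp.single (κ v) 1 = m} : ℤ)

open Classical in
/-- The `P`-elementary function: the sum of `u_{i₁} ⋯ u_{i_k}` over all `i₁ < ⋯ < i_k` in `P`. -/
def elemP (P : Type*) [PartialOrder P] [Fintype P] (k : ℕ) : MvPolynomial P ℤ :=
  ∑ f : Fin k → P with StrictMono f, ∏ i, MvPolynomial.X (f i)

/-- `ψ` is the ring homomorphism from symmetric functions to `ℤ[u]` with `e_k ↦ e_k^P`; the
`P`-analog of a symmetric function is its image under this homomorphism. -/
def IsPAnalogHom (P : Type*) [PartialOrder P] [Fintype P]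
    (ψ : symFun →+* MvPolynomial P ℤ) : Prop :=
  ∀ k : ℕ, ψ ⟨esymm k, esymm_mem k⟩ = elemP P k

/-! ### Cylindric tableaux

Boxes are `(row, column)`, both counted from `0`, as in Mathlib's `YoungDiagram`. Thus
`colLen j` is the `(j+1)`-st part of the transpose partition, and `lam.rowLen 0` is the number of
columns of `lam`. -/

/-- The boxes of the skew diagram whose column `j` occupies the rows `β j ≤ i < α j`. -/
def colShape (α β : ℕ → ℕ) : Set (ℕ × ℕ) := {b | β b.2 ≤ b.1 ∧ b.1 < α b.2}

/-- A filling of a set of boxes is a `P`-tableau if it is increasing down columns and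
non-decreasing (no entry is larger than its right neighbor) across rows. -/
def IsPTableau {P : Type*} [PartialOrder P] {S : Set (ℕ × ℕ)} (T : S → P) : Prop :=
  (∀ (i j : ℕ) (h : (i, j) ∈ S) (h' : (i + 1, j) ∈ S), T ⟨(i, j), h⟩ < T ⟨(i + 1, j), h'⟩) ∧
  (∀ (i j : ℕ) (h : (i, j) ∈ S) (h' : (i, j + 1) ∈ S), ¬ T ⟨(i, j + 1), h'⟩ < T ⟨(i, j), h⟩)

/-- `lam/mu/d` is a cylindric shape. -/
structure IsCylindricShape (lam mu : YoungDiagram) (d : ℕ) : Prop where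
  sub : mu ≤ lam
  lower_outer : lam.colLen 0 - lam.colLen (lam.rowLen 0 - 1) ≤ d
  lower_inner : mu.colLen 0 - mu.colLen (lam.rowLen 0 - 1) ≤ d
  upper : d ≤ lam.colLen 0

/-- The boxes of the skew shape `lam/mu`. -/
abbrev SkewBox (lam mu : YoungDiagram) : Type := {b : ℕ × ℕ // b ∈ lam.cells \ mu.cells}

/-- Column lengths `(κ'_1 + d, …, κ'_l + d, κ'_1)` of the diagram obtained from `κ`, regarded as
having `l` columns, by appending a copy of the first column shifted up by `d` cells. -/
def gluedCol (l d : ℕ) (κ : YoungDiagram) (j : ℕ) : ℕ :=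
  if j < l then κ.colLen j + d else if j = l then κ.colLen 0 else 0

/-- The boxes of the shape of `T^d`, for `T` of shape `lam/mu`. -/
abbrev gluedShape (lam mu : YoungDiagram) (d : ℕ) : Set (ℕ × ℕ) :=
  colShape (gluedCol (lam.rowLen 0) d lam) (gluedCol (lam.rowLen 0) d mu)

/-- The box of `lam/mu` of which a box of the shape of `T^d` is a copy. -/
def unglue (lam mu : YoungDiagram) (d : ℕ) (b : gluedShape lam mu d) : SkewBox lam mu :=
  ⟨if b.1.2 < lam.rowLen 0 then (b.1.1 - d, b.1.2) else (b.1.1, 0), by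
    obtain ⟨⟨i, j⟩, h1, h2⟩ := b
    simp only [gluedCol] at h1 h2
    simp only [Finset.mem_sdiff, YoungDiagram.mem_cells]
    split_ifs at h1 h2 ⊢ with h3 h4
    · rw [YoungDiagram.mem_iff_lt_colLen, YoungDiagram.mem_iff_lt_colLen]; omega
    · rw [YoungDiagram.mem_iff_lt_colLen, YoungDiagram.mem_iff_lt_colLen]; omega
    · omega⟩

/-- The filling `T^d`: a copy of the first column of `T`, shifted up by `d` cells, is glued to the
right of the last column of `T`. -/
def glue {P : Type*} {lam mu : YoungDiagram} (d : ℕ) (T : SkewBox lam mu → P) :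
    gluedShape lam mu d → P :=
  fun b => T (unglue lam mu d b)

/-- The filling `T` of `lam/mu` is a cylindric `P`-tableau of shape `lam/mu/d`. -/
def IsCylindricPTableau {P : Type*} [PartialOrder P] {lam mu : YoungDiagram} (d : ℕ)
    (T : SkewBox lam mu → P) : Prop :=
  IsPTableau (glue d T)

/-- A filling is standard if it contains each element of `P` exactly once. -/
def IsStandard {P : Type*} {lam mu : YoungDiagram} (T : SkewBox lam mu → P) : Prop :=
  ∀ p : P, ∃! b, T b = p

/-- The cylindric Schur function `s_{lam/mu/d}`: the coefficient of `x^m` is the number of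
cylindric semistandard Young tableaux of shape `lam/mu/d` (cylindric `P`-tableaux for the total
order `P = ℕ` of the variables) in which each `i` occurs `m i` times. -/
def cylSchur (lam mu : YoungDiagram) (d : ℕ) : MvPowerSeries ℕ ℤ :=
  fun m => (Nat.card {T : SkewBox lam mu → ℕ //
    IsCylindricPTableau d T ∧ ∑ b, Finsupp.single (T b) 1 = m} : ℤ)

/-- The exponent of the monomial `u_P`, the product of all variables `u_p`. -/
def uP (P : Type*) [Fintype P] : P →₀ ℕ := ∑ p : P, Finsupp.single p 1

end

end CylP

/-! Put the entry in row `i` and column `j` at time `i - j`. A filling with increasing columns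
becomes an array of `l` chains on a cylinder of period `N = l + d`; chain `j` starts at `colStart l
mu j` and ends at `colStart l lam j`. The remaining conditions compare an entry at time `x + 1` with
the entry of the next column at time `x` (`Flawless`).

For a (3+1)-free poset `Q`, count all arrays of chains with given content and starts whose ends
agree with those of `lam` up to a permutation and multiples of `N`, with the right total, weighted
by the sign of the permutation. Exchanging two tails after congruent times multiplies the
permutation by a transposition. If the two cut points have the same entries of the next level above
them (`BadPair`), the exchange yields chains again, and arrays with such a pair cancel. The heart is
that the surviving arrays are the flawless ones. Call the set of chains whose next entry lies above
a given entry its row. If the rows at each time are distinct, (3+1)-freeness makes them nested, by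
descent to smaller entries (`MaxUnnested.exists_pred`). So they form a staircase and no two chains
cross (`eq_of_crossing`), whereas an earliest flaw would be a crossing. Flawless arrays have the
trivial permutation and the exact ends (`CyclicAnti.eq_of_modEq`), so they are the cylindric
tableaux.

The signed count is also a coefficient of an integer combination of products of the `chainSeries Q
k`, with multipliers independent of `Q` (`coeff_sum_lengthSign_eq_card`). For `Q = ℕ` this expands
the cylindric Schur function in the `e_k`, which shows its symmetry. The homomorphism `ψ` turns this
into the same expansion for `Q = P`, whose coefficient at `u_P` counts standard tableaux.

The first equality holds for every symmetric `f`: the coefficient of `u_P` in `ψ f` is the sum of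
`c_ν` times the coefficient of `x^ν` in `f`. For `f = e_ν` the left side counts ordered partitions
of `P` into chains of sizes `ν_i`, that is, colorings of type `ν` of the incomparability graph.
Expand the chromatic function in the `e_ν'`; the coefficient of `x^ν` in `e_ν'` is symmetric in `ν`
and `ν'` by transposing 0-1 matrices. The bases and `ψ` come from the fundamental theorem on
symmetric polynomials in finitely many variables. -/

namespace CylP

set_option linter.unusedSectionVars false

/-! ### Generating series of chains in a poset -/

section ChainSeries

variable {Q : Type*} [PartialOrder Q]

/-- A multiset that consists of the elements of a chain, each with multiplicity one. -/
def IsChainMultiset (M : Multiset Q) : Prop := M.Nodup ∧ IsChain (· ≤ ·) {q | q ∈ M}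

open Classical in
/-- The sum of the monomials that are products of the elements of a chain with `k` elements. -/
noncomputable def chainSeries (Q : Type*) [PartialOrder Q] (k : ℕ) : MvPowerSeries Q ℤ := fun m =>
  if IsChainMultiset (Finsupp.toMultiset m) ∧ (Finsupp.toMultiset m).card = k then 1 else 0

/-- Sort along a linear extension of the order; since the elements are pairwise comparable, the
result increases in the original order too. -/
theorem exists_list_of_isChain {M : Multiset Q} (h : IsChainMultiset M) :
    ∃ L : List Q, L.IsChain (· < ·) ∧ (↑L : Multiset Q) = M := by
  set S : Finset (LinearExtension Q) := ⟨M, h.1⟩ with hS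
  suffices h1 : List.Pairwise (fun a b : Q => a < b) (S.sort : List Q) from
    ⟨S.sort, List.isChain_iff_pairwise.2 h1, Finset.sort_eq S (· ≤ ·)⟩
  have hsort : List.Pairwise (fun a b : LinearExtension Q => a < b) S.sort :=
    (Finset.sortedLT_sort S).pairwise
  refine List.Pairwise.imp_of_mem ?_ hsort
  intro a b ha hb hab
  replace ha : a ∈ M := (Finset.mem_sort (α := LinearExtension Q) (s := S) (· ≤ ·)).1 ha
  replace hb : b ∈ M := (Finset.mem_sort (α := LinearExtension Q) (s := S) (· ≤ ·)).1 hb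
  have hne : a ≠ b := ne_of_lt (α := LinearExtension Q) hab
  rcases h.2 (x := (a : Q)) ha (y := (b : Q)) hb hne with h1 | h1
  · exact lt_of_le_of_ne h1 hne
  · exact absurd ((toLinearExtension (α := Q)).monotone h1) (not_le_of_gt (α := LinearExtension Q) hab)

theorem isChainMultiset_coe {L : List Q} (h : L.IsChain (· < ·)) :
    IsChainMultiset (↑L : Multiset Q) := by
  rw [List.isChain_iff_pairwise] at h
  refine ⟨h.imp fun hab => hab.ne, ?_⟩
  intro a ha b hb hab
  have : Std.Symm fun a b : Q => a ≤ b ∨ b ≤ a := ⟨fun _ _ h => h.symm⟩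
  exact List.Pairwise.forall_of_forall (R := fun a b => a ≤ b ∨ b ≤ a)
    (fun _ _ => Or.inl le_rfl) (h.imp fun h => Or.inl h.le) ha hb

theorem list_eq_of_coe_eq {L L' : List Q} (h : L.IsChain (· < ·)) (h' : L'.IsChain (· < ·))
    (e : (↑L : Multiset Q) = ↑L') : L = L' := by
  rw [List.isChain_iff_pairwise] at h h'
  exact (Multiset.coe_eq_coe.1 e).eq_of_pairwise (fun a b _ _ h1 h2 => (h1.asymm h2).elim) h h'

theorem coeff_chainSeries (k : ℕ) (m : Q →₀ ℕ) [Decidable (IsChainMultiset (Finsupp.toMultiset m) ∧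
    (Finsupp.toMultiset m).card = k)] : MvPowerSeries.coeff m (chainSeries Q k) =
    if IsChainMultiset (Finsupp.toMultiset m) ∧ (Finsupp.toMultiset m).card = k then 1 else 0 := by
  rw [MvPowerSeries.coeff_apply, chainSeries]
  congr

theorem coeff_prod_chainSeries {ι : Type*} [Fintype ι] (n : ι → ℕ) (m : Q →₀ ℕ) :
    MvPowerSeries.coeff m (∏ i, chainSeries Q (n i)) =
      Nat.card {S : ι → Multiset Q // (∀ i, IsChainMultiset (S i)) ∧ (∀ i, (S i).card = n i) ∧
        ∑ i, S i = Finsupp.toMultiset m} := by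
  classical
  rw [MvPowerSeries.coeff_prod]
  simp only [coeff_chainSeries, Finset.prod_ite_zero, Finset.prod_const_one]
  rw [← Finset.sum_filter, Finset.sum_const, nsmul_eq_mul, mul_one, Nat.cast_inj,
    ← Fintype.card_coe, ← Nat.card_eq_fintype_card]
  refine Nat.card_congr
    { toFun := fun c => ⟨fun i => Finsupp.toMultiset (c.1 i), ?_⟩
      invFun := fun S => ⟨Finsupp.equivFunOnFinite.symm fun i => Multiset.toFinsupp (S.1 i), ?_⟩
      left_inv := fun c => ?_
      right_inv := fun S => ?_ }
  · have h := c.2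
    rw [Finset.mem_filter, Finset.mem_finsuppAntidiag] at h
    refine ⟨fun i => (h.2 i (Finset.mem_univ i)).1, fun i => (h.2 i (Finset.mem_univ i)).2, ?_⟩
    rw [← map_sum, h.1.1]
  · have h := S.2
    rw [Finset.mem_filter, Finset.mem_finsuppAntidiag]
    refine ⟨⟨?_, Finset.subset_univ _⟩, fun i _ => ?_⟩
    · simp only [Finsupp.equivFunOnFinite_symm_apply_apply]
      rw [← map_sum, h.2.2, Finsupp.toMultiset_toFinsupp]
    · simp only [Finsupp.equivFunOnFinite_symm_apply_apply, Multiset.toFinsupp_toMultiset]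
      exact ⟨h.1 i, h.2.1 i⟩
  · refine Subtype.ext (Finsupp.ext fun i => ?_)
    simp
  · refine Subtype.ext (funext fun i => ?_)
    simp

/-- Increasing lists, unlike multisets, can be cut and spliced. -/
theorem coeff_prod_chainSeries_list {ι : Type*} [Fintype ι] (n : ι → ℕ) (m : Q →₀ ℕ) :
    MvPowerSeries.coeff m (∏ i, chainSeries Q (n i)) =
      Nat.card {C : ι → List Q // (∀ i, (C i).IsChain (· < ·)) ∧ (∀ i, (C i).length = n i) ∧
        ∑ i, (↑(C i) : Multiset Q) = Finsupp.toMultiset m} := by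
  rw [coeff_prod_chainSeries, Nat.cast_inj]
  symm
  refine Nat.card_eq_of_bijective (fun C => ⟨fun i => ↑(C.1 i), fun i => isChainMultiset_coe (C.2.1 i),
    C.2.2.1, C.2.2.2⟩) ⟨fun C C' h => ?_, fun S => ?_⟩
  · refine Subtype.ext (funext fun i => list_eq_of_coe_eq (C.2.1 i) (C'.2.1 i) ?_)
    exact congrFun (congrArg Subtype.val h) i
  · choose L hL1 hL2 using fun i => exists_list_of_isChain (S.2.1 i)
    refine ⟨⟨L, hL1, fun i => ?_, ?_⟩, Subtype.ext (funext hL2)⟩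
    · rw [← Multiset.coe_card, hL2]
      exact S.2.2.1 i
    · rw [Finset.sum_congr rfl fun i _ => hL2 i]
      exact S.2.2.2

theorem toMultiset_injective {α : Type*} :
    Function.Injective (Finsupp.toMultiset : (α →₀ ℕ) → Multiset α) := by
  classical
  exact Function.LeftInverse.injective Finsupp.toMultiset_toFinsupp

theorem nodup_toMultiset {α : Type*} (m : α →₀ ℕ) :
    (Finsupp.toMultiset m).Nodup ↔ ∀ i, m i ≤ 1 := by
  classical
  rw [Multiset.nodup_iff_count_le_one]
  simp only [Finsupp.count_toMultiset]

theorem card_toMultiset_eq_degree {α : Type*} (m : α →₀ ℕ) :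
    (Finsupp.toMultiset m).card = m.degree := by
  rw [Finsupp.card_toMultiset, Finsupp.degree_apply]
  rfl

/-- Every subset of `ℕ` is a chain. With `coe_elemP`, both sides of `ψ` become instances of one
series. -/
theorem esymm_eq_chainSeries (k : ℕ) : esymm k = chainSeries ℕ k := by
  classical
  funext m
  rw [esymm, chainSeries]
  refine if_congr ?_ rfl rfl
  rw [IsChainMultiset, nodup_toMultiset, card_toMultiset_eq_degree]
  simp [isChain_of_trichotomous]

theorem coe_elemP (P : Type*) [PartialOrder P] [Fintype P] (k : ℕ) :
    ((elemP P k : MvPolynomial P ℤ) : MvPowerSeries P ℤ) = chainSeries P k := by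
  classical
  ext m
  rw [MvPolynomial.coeff_coe, coeff_chainSeries, elemP, MvPolynomial.coeff_sum]
  have hX : ∀ f : Fin k → P, ∏ i, (MvPolynomial.X (f i) : MvPolynomial P ℤ) =
      MvPolynomial.monomial (∑ i, Finsupp.single (f i) 1) 1 := by
    intro f
    rw [MvPolynomial.monomial_sum_one]
    rfl
  have hM : ∀ f : Fin k → P, Finsupp.toMultiset (∑ i, Finsupp.single (f i) 1) =
      (↑(List.ofFn f) : Multiset P) := by
    intro f
    rw [map_sum, ← Fin.univ_val_map, ← Multiset.sum_map_singleton (Multiset.map f _),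
      Multiset.map_map, Finset.sum_eq_multiset_sum]
    simp
  have hmono : ∀ f : Fin k → P, StrictMono f ↔ (List.ofFn f).IsChain (· < ·) := by
    intro f
    rw [List.isChain_iff_pairwise, List.pairwise_ofFn]
    rfl
  simp only [hX, MvPolynomial.coeff_monomial]
  rw [← Finset.sum_filter, Finset.sum_const, nsmul_eq_mul, mul_one]
  split_ifs with h
  · obtain ⟨L, hL, hLm⟩ := exists_list_of_isChain h.1
    have hlen : L.length = k := by rw [← h.2, ← hLm]; rfl
    subst hlen
    rw [Nat.cast_eq_one, Finset.card_eq_one]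
    refine ⟨L.get, ?_⟩
    ext f
    rw [Finset.mem_filter, Finset.mem_filter, Finset.mem_singleton, hmono,
      ← toMultiset_injective.eq_iff, hM, ← hLm]
    constructor
    · rintro ⟨⟨-, h1⟩, h2⟩
      apply List.ofFn_injective
      rw [list_eq_of_coe_eq h1 hL h2, List.ofFn_get]
    · rintro rfl
      rw [List.ofFn_get]
      exact ⟨⟨Finset.mem_univ _, hL⟩, rfl⟩
  · rw [Nat.cast_eq_zero, Finset.card_eq_zero, Finset.filter_eq_empty_iff]
    intro f hf hfm
    rw [Finset.mem_filter, hmono] at hf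
    apply h
    rw [← hfm, hM]
    exact ⟨isChainMultiset_coe hf.2, by simp⟩

end ChainSeries

/-! ### Monomials up to permutation of the variables -/

section MonomialType

variable {α β : Type*}

/-- The multiset of the nonzero exponents of a monomial. -/
def expType (m : α →₀ ℕ) : Multiset ℕ := m.support.val.map m

theorem sum_expType (m : α →₀ ℕ) : (expType m).sum = m.degree := by
  rw [Finsupp.degree_apply]
  rfl

theorem pos_of_mem_expType {m : α →₀ ℕ} {k : ℕ} (h : k ∈ expType m) : 0 < k := by
  obtain ⟨i, hi, rfl⟩ := Multiset.mem_map.1 h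
  exact Nat.pos_of_ne_zero (Finsupp.mem_support_iff.1 hi)

theorem expType_embDomain (e : α ↪ β) (m : α →₀ ℕ) :
    expType (Finsupp.embDomain e m) = expType m := by
  rw [expType, Finsupp.support_embDomain, Finset.map_val, Multiset.map_map, expType]
  exact Multiset.map_congr rfl fun i _ => Finsupp.embDomain_apply_self e m i

theorem card_support_le_degree (m : α →₀ ℕ) : m.support.card ≤ m.degree := by
  rw [Finsupp.degree_apply, Finset.card_eq_sum_ones]
  exact Finset.sum_le_sum fun i hi => Nat.pos_of_ne_zero (Finsupp.mem_support_iff.1 hi)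

/-- A monomial of degree at most `n` involves at most `n` variables, so `n` variables realize its
type. -/
theorem exists_fin_expType_eq (m : α →₀ ℕ) {n : ℕ} (h : m.degree ≤ n) :
    ∃ x : Fin n →₀ ℕ, expType x = expType m := by
  obtain ⟨e⟩ : Nonempty (m.support ↪ Fin n) := by
    refine Function.Embedding.nonempty_of_card_le ?_
    rw [Fintype.card_coe, Fintype.card_fin]
    exact (card_support_le_degree m).trans h
  refine ⟨Finsupp.embDomain e (m.subtypeDomain (· ∈ m.support)), ?_⟩
  rw [expType_embDomain, ← expType_embDomain (Function.Embedding.subtype (· ∈ m.support))]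
  congr 1
  ext i
  by_cases hi : i ∈ m.support
  · exact Finsupp.embDomain_apply_self (Function.Embedding.subtype (· ∈ m.support)) _ ⟨i, hi⟩
  · rw [Finsupp.embDomain_of_notMem_range, Finsupp.notMem_support_iff.1 hi]
    rintro ⟨j, rfl⟩
    exact hi j.2

theorem exists_expType_eq {M : Multiset ℕ} (hM : ∀ k ∈ M, 0 < k) :
    ∃ m : ℕ →₀ ℕ, expType m = M := by
  induction M using Quotient.inductionOn with
  | _ L =>
    refine ⟨Finsupp.embDomain Fin.valEmbedding (Finsupp.equivFunOnFinite.symm L.get), ?_⟩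
    have h : (Finsupp.equivFunOnFinite.symm L.get).support = Finset.univ := by
      ext i
      simpa using (hM _ (L.get_mem i)).ne'
    rw [expType_embDomain, expType, h]
    simp

open Classical in
theorem card_fiber_eq_count (m : α →₀ ℕ) {c : ℕ} (hc : c ≠ 0) :
    Finite {i // m i = c} ∧ Nat.card {i // m i = c} = (expType m).count c := by
  have h : ∀ i, m i = c ↔ i ∈ m.support.filter (fun i => c = m i) := by
    intro i
    rw [Finset.mem_filter, Finsupp.mem_support_iff]
    constructor
    · rintro rfl
      exact ⟨hc, rfl⟩
    · exact fun h => h.2.symm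
  have e : {i // m i = c} ≃ {i // i ∈ m.support.filter (fun i => c = m i)} :=
    Equiv.subtypeEquivRight h
  refine ⟨Finite.of_equiv _ e.symm, ?_⟩
  rw [Nat.card_congr e, Nat.card_eq_fintype_card, Fintype.card_coe, expType, Multiset.count_map]
  rfl

theorem infinite_fiber_zero (m : ℕ →₀ ℕ) : Infinite {i // m i = 0} := by
  have h : {i | m i = 0}.Infinite := by
    have := m.support.finite_toSet.infinite_compl
    refine this.mono fun i hi => ?_
    simpa using hi
  exact h.to_subtype

/-- The fibers over a nonzero exponent are finite of equal size, and those over zero are countably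
infinite; bijections between them glue to a permutation. -/
theorem exists_perm_of_expType_eq {m m' : ℕ →₀ ℕ} (h : expType m = expType m') :
    ∃ σ : Equiv.Perm ℕ, Finsupp.embDomain σ.toEmbedding m = m' := by
  classical
  have e : ∀ c, Nonempty ({i // m i = c} ≃ {i // m' i = c}) := by
    intro c
    by_cases hc : c = 0
    · subst hc
      have := infinite_fiber_zero m
      have := infinite_fiber_zero m'
      exact nonempty_equiv_of_countable
    · obtain ⟨h1, h2⟩ := card_fiber_eq_count m hc
      obtain ⟨h3, h4⟩ := card_fiber_eq_count m' hc
      exact Finite.card_eq.1 (by rw [h2, h4, h])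
  set σ : Equiv.Perm ℕ := Equiv.ofFiberEquiv fun c => (e c).some with hσ
  refine ⟨σ, ?_⟩
  ext i
  obtain ⟨j, rfl⟩ := σ.surjective i
  have h1 := Finsupp.embDomain_apply_self σ.toEmbedding m j
  rw [Equiv.coe_toEmbedding] at h1
  rw [h1]
  exact (Equiv.ofFiberEquiv_map (f := m) (g := m') (fun c => (e c).some) j).symm

theorem expType_mapDomain_perm (σ : Equiv.Perm α) (m : α →₀ ℕ) :
    expType (Finsupp.mapDomain σ m) = expType m := by
  rw [← expType_embDomain σ.toEmbedding m, Finsupp.embDomain_eq_mapDomain]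
  rfl

theorem mem_symFun_iff {f : MvPowerSeries ℕ ℤ} : f ∈ symFun ↔
    (∀ m m', expType m = expType m' → MvPowerSeries.coeff m f = MvPowerSeries.coeff m' f) ∧
      ∃ N : ℕ, ∀ m : ℕ →₀ ℕ, N < m.degree → MvPowerSeries.coeff m f = 0 := by
  refine and_congr_left' ⟨fun h m m' hm => ?_, fun h σ => ?_⟩
  · obtain ⟨σ, rfl⟩ := exists_perm_of_expType_eq hm
    rw [← MvPowerSeries.coeff_embDomain_rename σ.toEmbedding f m]
    exact congrArg _ (h σ)
  · ext m
    obtain ⟨m, rfl⟩ : ∃ m', m = Finsupp.embDomain σ.toEmbedding m' := by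
      refine ⟨Finsupp.mapDomain σ.symm m, ?_⟩
      rw [Finsupp.embDomain_eq_mapDomain, ← Finsupp.mapDomain_comp]
      have : (σ.toEmbedding ∘ σ.symm : ℕ → ℕ) = id := by
        funext i
        simp
      rw [this, Finsupp.mapDomain_id]
    have h3 : MvPowerSeries.coeff (Finsupp.embDomain σ.toEmbedding m)
        (MvPowerSeries.renameEquiv ℤ σ f) = MvPowerSeries.coeff m f :=
      MvPowerSeries.coeff_embDomain_rename σ.toEmbedding f m
    rw [h3]
    exact h _ _ (expType_embDomain _ _).symm

end MonomialType

/-! ### The monomial basis -/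

section MonomialBasis

/-- A monomial whose multiset of nonzero exponents is the multiset of parts of `ν`. -/
noncomputable def expOf (ν : Ptn) : ℕ →₀ ℕ :=
  (exists_expType_eq (M := ν.2.parts) fun _ h => ν.2.parts_pos h).choose

theorem expType_expOf (ν : Ptn) : expType (expOf ν) = ν.2.parts :=
  (exists_expType_eq (M := ν.2.parts) fun _ h => ν.2.parts_pos h).choose_spec

theorem ptn_ext {ν ν' : Ptn} (h : ν.2.parts = ν'.2.parts) : ν = ν' := by
  obtain ⟨n, p⟩ := ν
  obtain ⟨n', p'⟩ := ν'
  obtain rfl : n = n' := by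
    rw [← p.parts_sum, ← p'.parts_sum]
    exact congrArg _ h
  congr 1
  exact Nat.Partition.ext h

/-- The partition whose parts are the nonzero exponents of a monomial. -/
noncomputable def ptnOf (m : ℕ →₀ ℕ) : Ptn := ⟨m.degree, expType m, pos_of_mem_expType, sum_expType m⟩

theorem ptnOf_expOf (ν : Ptn) : ptnOf (expOf ν) = ν := ptn_ext (expType_expOf ν)

open Classical in
theorem coeff_msymm (m : ℕ →₀ ℕ) (ν : Ptn) :
    MvPowerSeries.coeff m (msymm ν) = if ptnOf m = ν then 1 else 0 := by
  rw [MvPowerSeries.coeff_apply, msymm]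
  refine if_congr ⟨fun h => ptn_ext h, fun h => ?_⟩ rfl rfl
  rw [← h]
  rfl

theorem coeff_sum_msymm (a : Ptn →₀ ℤ) (m : ℕ →₀ ℕ) :
    MvPowerSeries.coeff m (a.sum fun ν z => z • msymm ν) = a (ptnOf m) := by
  classical
  rw [Finsupp.sum, map_sum]
  simp only [map_zsmul, coeff_msymm, smul_eq_mul, mul_ite, mul_one, mul_zero]
  rw [Finset.sum_ite_eq]
  split_ifs with h
  · rfl
  · exact (Finsupp.notMem_support_iff.1 h).symm

theorem existsUnique_sum_msymm {f : MvPowerSeries ℕ ℤ} (hf : f ∈ symFun) :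
    ∃! a : Ptn →₀ ℤ, f = a.sum fun ν z => z • msymm ν := by
  classical
  rw [mem_symFun_iff] at hf
  obtain ⟨h, N, hN⟩ := hf
  refine ⟨Finsupp.onFinset ((Finset.range (N + 1)).sigma fun _ => Finset.univ)
    (fun ν => MvPowerSeries.coeff (expOf ν) f) fun ν hν => ?_, ?_, fun a ha => ?_⟩
  · rw [Finset.mem_sigma, Finset.mem_range]
    refine ⟨?_, Finset.mem_univ _⟩
    by_contra h1
    refine hν (hN _ ?_)
    rw [← sum_expType, expType_expOf, ν.2.parts_sum]
    omega
  · ext m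
    rw [coeff_sum_msymm, Finsupp.onFinset_apply]
    exact h _ _ (expType_expOf (ptnOf m)).symm
  · ext ν
    rw [Finsupp.onFinset_apply, ha, coeff_sum_msymm, ptnOf_expOf]

end MonomialBasis

/-! ### Polynomials in the elementary symmetric functions -/

section ElementaryPolynomials

/-- The substitution of `e_{k+1}` for the variable with index `k`. -/
noncomputable def esymmEval : MvPolynomial ℕ ℤ →ₐ[ℤ] MvPowerSeries ℕ ℤ :=
  MvPolynomial.aeval fun k => esymm (k + 1)

/-- The partition whose part `k + 1` has multiplicity `d k`. -/
noncomputable def succPtn (d : ℕ →₀ ℕ) : Ptn :=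
  ⟨((Finsupp.toMultiset d).map (· + 1)).sum, (Finsupp.toMultiset d).map (· + 1),
    fun h => by
      obtain ⟨k, -, rfl⟩ := Multiset.mem_map.1 h
      exact k.succ_pos, rfl⟩

/-- The exponent `d` with `succPtn d = ν`. -/
noncomputable def predExp (ν : Ptn) : ℕ →₀ ℕ := Multiset.toFinsupp (ν.2.parts.map (· - 1))

theorem succPtn_predExp (ν : Ptn) : succPtn (predExp ν) = ν := by
  refine ptn_ext ?_
  change (Finsupp.toMultiset (predExp ν)).map (· + 1) = _
  rw [predExp, Multiset.toFinsupp_toMultiset, Multiset.map_map]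
  refine (Multiset.map_congr rfl fun k hk => ?_).trans (Multiset.map_id _)
  have := ν.2.parts_pos hk
  simp only [Function.comp_apply, id_eq]
  omega

theorem succPtn_injective : Function.Injective succPtn := by
  intro d d' h
  have h1 : (succPtn d).2.parts = (succPtn d').2.parts := by rw [h]
  exact toMultiset_injective (Multiset.map_injective (add_left_injective 1) h1)

theorem esymmEval_monomial (d : ℕ →₀ ℕ) (z : ℤ) :
    esymmEval (MvPolynomial.monomial d z) = z • esymmPart (succPtn d) := by
  rw [esymmEval, MvPolynomial.aeval_monomial, esymmPart, succPtn, Multiset.map_map,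
    Finsupp.toMultiset_map, Finsupp.prod_toMultiset, Finsupp.prod_mapDomain_index, zsmul_eq_mul,
    eq_intCast (algebraMap ℤ (MvPowerSeries ℕ ℤ))]
  · rfl
  · exact fun _ => pow_zero _
  · exact fun _ _ _ => pow_add _ _ _

theorem esymmEval_eq_sum (G : MvPolynomial ℕ ℤ) :
    esymmEval G = ∑ d ∈ G.support, G.coeff d • esymmPart (succPtn d) := by
  conv_lhs => rw [G.as_sum, map_sum]
  exact Finset.sum_congr rfl fun d _ => esymmEval_monomial d _

theorem esymmEval_mem (G : MvPolynomial ℕ ℤ) : esymmEval G ∈ symFun := by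
  rw [esymmEval_eq_sum]
  refine sum_mem fun d _ => zsmul_mem (multiset_prod_mem _ fun f hf => ?_) _
  obtain ⟨k, -, rfl⟩ := Multiset.mem_map.1 hf
  exact esymm_mem k

theorem isHomogeneous_esymm (k : ℕ) : (esymm k).IsHomogeneous k := by
  intro m hm
  have h1 : Finsupp.weight 1 m = m.degree := by
    rw [Finsupp.degree_eq_weight_one]
    rfl
  rw [h1]
  by_contra h
  refine hm ?_
  rw [MvPowerSeries.coeff_apply, esymm, if_neg fun h1 => h h1.2]

theorem isHomogeneous_prod_esymm (M : Multiset ℕ) :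
    (M.map esymm).prod.IsHomogeneous M.sum := by
  classical
  induction M using Multiset.induction_on with
  | empty =>
    intro m hm
    rw [Multiset.map_zero, Multiset.prod_zero, MvPowerSeries.coeff_one] at hm
    by_cases h : m = 0
    · simp [h]
    · exact absurd (if_neg h) hm
  | cons k M ih =>
    rw [Multiset.map_cons, Multiset.prod_cons, Multiset.sum_cons]
    exact MvPowerSeries.IsHomogeneous.mul (isHomogeneous_esymm k) ih

theorem coeff_esymmPart_eq_zero {ν : Ptn} {m : ℕ →₀ ℕ} (h : m.degree ≠ ν.1) :
    MvPowerSeries.coeff m (esymmPart ν) = 0 := by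
  refine MvPowerSeries.IsHomogeneous.coeff_eq_zero (isHomogeneous_prod_esymm ν.2.parts) ?_
  rwa [ν.2.parts_sum]

end ElementaryPolynomials

/-! ### Reduction to finitely many variables -/

section FiniteVariables

theorem killCompl_esymm (N k : ℕ) : MvPowerSeries.killCompl (Fin.valEmbedding (n := N)) (esymm k) =
    (MvPolynomial.esymm (Fin N) ℤ k : MvPolynomial (Fin N) ℤ) := by
  classical
  ext x
  rw [MvPowerSeries.coeff_killCompl, MvPolynomial.coeff_coe, MvPolynomial.esymm_eq_sum_monomial,
    MvPolynomial.coeff_sum, esymm_eq_chainSeries, coeff_chainSeries]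
  simp only [MvPolynomial.coeff_monomial]
  have hT : ∀ t : Finset (Fin N), ∑ i ∈ t, Finsupp.single i 1 = Multiset.toFinsupp t.val := by
    intro t
    refine toMultiset_injective ?_
    rw [Multiset.toFinsupp_toMultiset, map_sum]
    simp only [Finsupp.toMultiset_single, one_smul]
    exact Finset.sum_multiset_singleton t
  have hE : Finsupp.toMultiset (Finsupp.embDomain Fin.valEmbedding x) =
      (Finsupp.toMultiset x).map Fin.valEmbedding := by
    rw [Finsupp.embDomain_eq_mapDomain, Finsupp.toMultiset_map]
  have hC : IsChainMultiset (Finsupp.toMultiset (Finsupp.embDomain Fin.valEmbedding x)) ↔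
      (Finsupp.toMultiset x).Nodup := by
    rw [IsChainMultiset, and_iff_left (isChain_of_trichotomous _), hE,
      Multiset.nodup_map_iff_of_injective Fin.valEmbedding.injective]
  rw [hC, hE, Multiset.card_map]
  split_ifs with h
  · rw [Finset.sum_eq_single_of_mem ⟨Finsupp.toMultiset x, h.1⟩, if_pos]
    · rw [hT, Finsupp.toMultiset_toFinsupp]
    · rw [Finset.mem_powersetCard_univ]
      exact h.2
    · intro t _ ht
      rw [if_neg]
      intro h1
      refine ht (Finset.val_injective ?_)
      change t.val = Finsupp.toMultiset x
      rw [← h1, hT, Multiset.toFinsupp_toMultiset]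
  · symm
    refine Finset.sum_eq_zero fun t ht => if_neg fun h1 => h ?_
    rw [Finset.mem_powersetCard_univ] at ht
    rw [← h1, hT, Multiset.toFinsupp_toMultiset]
    exact ⟨t.nodup, ht⟩

theorem killCompl_esymmEval_rename (N : ℕ) (G : MvPolynomial (Fin N) ℤ) :
    MvPowerSeries.killCompl (Fin.valEmbedding (n := N))
      (esymmEval (MvPolynomial.rename Fin.val G)) =
      ((MvPolynomial.esymmAlgHom (Fin N) ℤ N G : MvPolynomial (Fin N) ℤ) :
        MvPowerSeries (Fin N) ℤ) := by
  have h1 : (MvPolynomial.esymmAlgHom (Fin N) ℤ N G : MvPolynomial (Fin N) ℤ) =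
      MvPolynomial.aeval (fun i : Fin N => MvPolynomial.esymm (Fin N) ℤ (i + 1)) G :=
    MvPolynomial.esymmAlgHom_apply _
  rw [h1]
  have h2 : ((MvPowerSeries.killCompl (Fin.valEmbedding (n := N)) :
        MvPowerSeries ℕ ℤ →ₐ[ℤ] _).toRingHom.comp
      (esymmEval.toRingHom.comp (MvPolynomial.rename Fin.val).toRingHom)) =
      MvPolynomial.coeToMvPowerSeries.ringHom.comp
        (MvPolynomial.aeval fun i : Fin N =>
          MvPolynomial.esymm (Fin N) ℤ (i + 1)).toRingHom := by
    refine MvPolynomial.ringHom_ext (fun z => ?_) fun i => ?_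
    · simp
    · simp [esymmEval, killCompl_esymm]
  exact RingHom.congr_fun h2 G

/-- A relation among `e_1, …, e_N` survives restriction to `N` variables, where these are
algebraically independent. -/
theorem esymmEval_injective : Function.Injective esymmEval := by
  rw [injective_iff_map_eq_zero]
  intro G hG
  obtain ⟨N, hN⟩ : ∃ N, ∀ k ∈ G.vars, k < N := by
    obtain ⟨N, hN⟩ := G.vars.bddAbove
    exact ⟨N + 1, fun k hk => Nat.lt_succ_of_le (hN hk)⟩
  obtain ⟨G', rfl⟩ := MvPolynomial.exists_rename_eq_of_vars_subset_range G (Fin.val : Fin N → ℕ)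
    Fin.val_injective fun k hk => ⟨⟨k, hN k hk⟩, rfl⟩
  have h := killCompl_esymmEval_rename N G'
  rw [hG, map_zero] at h
  have h1 : G' = 0 := by
    refine MvPolynomial.esymmAlgHom_fin_injective ℤ le_rfl ?_
    rw [map_zero]
    refine Subtype.ext (MvPolynomial.coe_injective _ _ ?_)
    rw [← h]
    exact MvPolynomial.coe_zero.symm
  rw [h1, map_zero]

/-- All monomial types of degree at most `n` occur in `n` variables. Restricting to these and
truncating leaves a symmetric polynomial, to which the finite theorem applies. -/
theorem exists_esymmEval_coeff_eq {f : MvPowerSeries ℕ ℤ} (hf : f ∈ symFun) (n : ℕ) :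
    ∃ G, ∀ m : ℕ →₀ ℕ, m.degree ≤ n →
      MvPowerSeries.coeff m (esymmEval G) = MvPowerSeries.coeff m f := by
  rw [mem_symFun_iff] at hf
  set g := MvPowerSeries.truncTotal (n + 1) (MvPowerSeries.killCompl (Fin.valEmbedding (n := n)) f)
    with hg
  have hcoeff : ∀ x, g.coeff x = if x.degree < n + 1 then
      MvPowerSeries.coeff (Finsupp.embDomain Fin.valEmbedding x) f else 0 := by
    intro x
    rw [hg, MvPowerSeries.coeff_truncTotal_eq_ite]
    rfl
  have hsym : g.IsSymmetric := by
    intro σ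
    ext x
    obtain ⟨y, rfl⟩ : ∃ y, x = Finsupp.mapDomain σ y := by
      refine ⟨Finsupp.mapDomain σ.symm x, ?_⟩
      rw [← Finsupp.mapDomain_comp]
      simp
    rw [MvPolynomial.coeff_rename_mapDomain _ σ.injective, hcoeff, hcoeff,
      Finsupp.degree_mapDomain]
    refine if_congr Iff.rfl (hf.1 _ _ ?_) rfl
    rw [expType_embDomain, expType_embDomain, expType_mapDomain_perm]
  obtain ⟨G', hG'⟩ := (MvPolynomial.esymmAlgHom_fin_bijective ℤ n).2 ⟨g, hsym⟩
  refine ⟨MvPolynomial.rename Fin.val G', fun m hm => ?_⟩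
  obtain ⟨x, hx⟩ := exists_fin_expType_eq m hm
  have hx' : expType (Finsupp.embDomain Fin.valEmbedding x) = expType m := by
    rw [expType_embDomain, hx]
  rw [← (mem_symFun_iff.1 (esymmEval_mem _)).1 _ _ hx', ← hf.1 _ _ hx',
    ← MvPowerSeries.coeff_killCompl, killCompl_esymmEval_rename, hG', MvPolynomial.coeff_coe,
    hcoeff, if_pos]
  rw [← sum_expType, hx, sum_expType]
  omega

theorem exists_esymmEval_eq {f : MvPowerSeries ℕ ℤ} (hf : f ∈ symFun) :
    ∃ G, esymmEval G = f := by
  classical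
  obtain ⟨n, hn⟩ := (mem_symFun_iff.1 hf).2
  obtain ⟨G, hG⟩ := exists_esymmEval_coeff_eq hf n
  -- `G` is controlled only up to degree `n`. Each `esymmPart` is homogeneous, so terms of larger
  -- degree can be dropped.
  refine ⟨∑ d ∈ G.support with (succPtn d).1 ≤ n, MvPolynomial.monomial d (G.coeff d), ?_⟩
  rw [map_sum]
  simp only [esymmEval_monomial]
  ext m
  rw [map_sum]
  rcases lt_or_ge n m.degree with h | h
  · rw [hn m h]
    refine Finset.sum_eq_zero fun d hd => ?_
    rw [map_zsmul, coeff_esymmPart_eq_zero, smul_zero]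
    have := (Finset.mem_filter.1 hd).2
    omega
  · rw [← hG m h, esymmEval_eq_sum, map_sum]
    refine Finset.sum_subset (Finset.filter_subset _ _) fun d hd hd' => ?_
    rw [map_zsmul, coeff_esymmPart_eq_zero, smul_zero]
    rintro h1
    exact hd' (Finset.mem_filter.2 ⟨hd, by omega⟩)

end FiniteVariables

/-! ### The elementary basis and the homomorphism `ψ` -/

section ElementaryBasis

theorem existsUnique_sum_esymmPart {f : MvPowerSeries ℕ ℤ} (hf : f ∈ symFun) :
    ∃! c : Ptn →₀ ℤ, f = c.sum fun ν z => z • esymmPart ν := by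
  classical
  set F : (Ptn →₀ ℤ) → MvPolynomial ℕ ℤ :=
    fun c => c.sum fun ν z => MvPolynomial.monomial (predExp ν) z with hF
  have hsum : ∀ c : Ptn →₀ ℤ, esymmEval (F c) = c.sum fun ν z => z • esymmPart ν := by
    intro c
    rw [hF]
    simp only [Finsupp.sum, map_sum, esymmEval_monomial, succPtn_predExp]
  have hcoeff : ∀ (c : Ptn →₀ ℤ) (d), (F c).coeff d = c (succPtn d) := by
    intro c d
    rw [hF]
    simp only [Finsupp.sum, MvPolynomial.coeff_sum, MvPolynomial.coeff_monomial]
    have : ∀ ν, predExp ν = d ↔ succPtn d = ν := by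
      intro ν
      rw [← succPtn_injective.eq_iff, succPtn_predExp, eq_comm]
    simp only [this, Finset.sum_ite_eq]
    split_ifs with h
    · rfl
    · exact (Finsupp.notMem_support_iff.1 h).symm
  obtain ⟨G, rfl⟩ := exists_esymmEval_eq hf
  refine ⟨Finsupp.onFinset (G.support.image succPtn) (fun ν => G.coeff (predExp ν))
    fun ν hν => ?_, ?_, fun c hc => ?_⟩
  · rw [Finset.mem_image]
    exact ⟨predExp ν, MvPolynomial.mem_support_iff.2 hν, succPtn_predExp ν⟩
  · dsimp only
    rw [← hsum]
    congr 1
    ext d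
    rw [hcoeff, Finsupp.onFinset_apply]
    congr 1
    exact succPtn_injective (succPtn_predExp _).symm
  · dsimp only at hc
    rw [← hsum] at hc
    ext ν
    rw [Finsupp.onFinset_apply, esymmEval_injective hc, hcoeff, succPtn_predExp]

theorem esymm_zero : esymm 0 = 1 := by
  classical
  ext m
  rw [MvPowerSeries.coeff_apply, esymm, MvPowerSeries.coeff_one]
  refine if_congr ?_ rfl rfl
  rw [Finsupp.degree_eq_zero_iff]
  exact ⟨fun h => h.2, fun h => ⟨by simp [h], h⟩⟩

theorem elemP_zero (P : Type*) [PartialOrder P] [Fintype P] : elemP P 0 = 1 := by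
  classical
  rw [elemP, Finset.filter_true_of_mem fun f _ => Subsingleton.strictMono f]
  simp

/-- The ring isomorphism from polynomials in the `e_{k+1}` to symmetric functions. -/
noncomputable def esymmEquiv : MvPolynomial ℕ ℤ ≃+* symFun :=
  RingEquiv.ofBijective (esymmEval.toRingHom.codRestrict symFun esymmEval_mem)
    ⟨fun _ _ h => esymmEval_injective (congrArg Subtype.val h), fun f => by
      obtain ⟨G, hG⟩ := exists_esymmEval_eq f.2
      exact ⟨G, Subtype.ext hG⟩⟩

theorem esymmEquiv_X (k : ℕ) :
    esymmEquiv (MvPolynomial.X k) = ⟨esymm (k + 1), esymm_mem (k + 1)⟩ :=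
  Subtype.ext (MvPolynomial.aeval_X _ k)

/-- The `e_k` with `k ≥ 1` are free generators, so their images can be prescribed; for `k = 0` both
sides are `1`. -/
theorem existsUnique_isPAnalogHom (P : Type*) [PartialOrder P] [Fintype P] :
    ∃! ψ : symFun →+* MvPolynomial P ℤ, IsPAnalogHom P ψ := by
  refine ⟨(MvPolynomial.aeval fun k => elemP P (k + 1)).toRingHom.comp
    (esymmEquiv.symm : symFun →+* MvPolynomial ℕ ℤ), ?_, fun ψ hψ => ?_⟩
  · rintro (_ | k)
    · have : (⟨esymm 0, esymm_mem 0⟩ : symFun) = 1 := Subtype.ext esymm_zero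
      rw [this, map_one, elemP_zero]
    · rw [← esymmEquiv_X]
      simp
  · refine RingHom.ext fun f => ?_
    obtain ⟨G, rfl⟩ := esymmEquiv.surjective f
    have h : ψ.comp (esymmEquiv : MvPolynomial ℕ ℤ →+* symFun) =
        (MvPolynomial.aeval fun k => elemP P (k + 1)).toRingHom := by
      refine MvPolynomial.ringHom_ext (fun z => ?_) fun k => ?_
      · simp
      · have := hψ (k + 1)
        rw [← esymmEquiv_X] at this
        simpa using this
    have h1 := RingHom.congr_fun h G
    simpa using h1

end ElementaryBasis

/-! ### Chains padded by `⊥` and `⊤` -/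

section Core

variable {Q : Type*} [PartialOrder Q]

/-- Consecutive entries of a chain that is padded by `⊥` in front and by `⊤` behind. -/
def Step (e e' : WithBot (WithTop Q)) : Prop := e < e' ∨ (e = e' ∧ (e = ⊥ ∨ e = ⊤))

theorem Step.le {e e' : WithBot (WithTop Q)} (h : Step e e') : e ≤ e' := by
  rcases h with h | ⟨h, -⟩
  · exact h.le
  · exact h.le

theorem Step.lt_of_ne {e e' : WithBot (WithTop Q)} (h : Step e e') (h1 : e ≠ ⊤) (h2 : e' ≠ ⊥) :
    e < e' := by
  rcases h with h | ⟨rfl, h | h⟩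
  · exact h
  · exact absurd h h2
  · exact absurd h h1

/-- Otherwise `y` would be incomparable to each of `e < e' < a`. Every use of (3+1)-freeness passes
through this lemma. -/
theorem ThreePlusOneFree.lt_of_not_lt (hQ : ThreePlusOneFree Q) {e e' a y : Q} (h : e < e')
    (h1 : ¬ e < y) (h2 : e' < a) : y < a := by
  by_contra h3
  refine hQ ⟨e, e', a, y, h, h2, ⟨fun h4 => ?_, fun h4 => ?_⟩, ⟨fun h4 => ?_, fun h4 => ?_⟩,
    ⟨fun h4 => ?_, fun h4 => ?_⟩⟩
  · exact h3 (h4.trans_lt (h.trans h2))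
  · rcases h4.lt_or_eq with h5 | rfl
    · exact h1 h5
    · exact h3 (h.trans h2)
  · exact h3 (h4.trans_lt h2)
  · exact h1 (h.trans_le h4)
  · rcases h4.lt_or_eq with h5 | rfl
    · exact h3 h5
    · exact h1 (h.trans h2)
  · exact h1 ((h.trans h2).trans_le h4)

/-- Padding is harmless: the cases with `⊥` or `⊤` are trivial or contradictory, since an entry
repeated by a step is itself `⊥` or `⊤`. -/
theorem ThreePlusOneFree.lt_of_step (hQ : ThreePlusOneFree Q) {e e' y a : WithBot (WithTop Q)}
    (h : Step e e') (h1 : ¬ e < y) (h2 : e' < a) : y < a := by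
  rcases h with h | ⟨rfl, rfl | rfl⟩
  · induction y using WithBot.recBotCoe with
    | bot => exact bot_le.trans_lt h2
    | coe y =>
    induction e using WithBot.recBotCoe with
    | bot => exact absurd (WithBot.bot_lt_coe y) h1
    | coe e =>
    induction e' using WithBot.recBotCoe with
    | bot => exact absurd h not_lt_bot
    | coe e' =>
    induction a using WithBot.recBotCoe with
    | bot => exact absurd h2 not_lt_bot
    | coe a =>
    rw [WithBot.coe_lt_coe] at *
    induction e using WithTop.recTopCoe with
    | top => exact absurd h not_top_lt
    | coe e =>
    induction e' using WithTop.recTopCoe with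
    | top => exact absurd h2 not_top_lt
    | coe e' =>
    induction y using WithTop.recTopCoe with
    | top => exact absurd (WithTop.coe_lt_top e) h1
    | coe y =>
    induction a using WithTop.recTopCoe with
    | top => exact WithTop.coe_lt_top y
    | coe a =>
    rw [WithTop.coe_lt_coe] at *
    exact hQ.lt_of_not_lt h h1 h2
  · rw [bot_lt_iff_ne_bot, not_not] at h1
    rwa [h1]
  · exact absurd h2 not_top_lt

/-! ### Systems of padded chains -/

section System

variable {ι : Type*} {A : ι → ℤ → WithBot (WithTop Q)} {R : ℤ → Finset ι}

open Classical in
/-- The chains of a system whose entry at time `x + 1` lies above the entry of the chain `i` at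
time `x`. -/
noncomputable def upRow (A : ι → ℤ → WithBot (WithTop Q)) (R : ℤ → Finset ι) (x : ℤ) (i : ι) : Finset ι :=
  {c ∈ R x | A i x < A c (x + 1)}

theorem mem_upRow {x : ℤ} {i c : ι} : c ∈ upRow A R x i ↔ c ∈ R x ∧ A i x < A c (x + 1) := by
  simp [upRow]

/-- The chain `i` has a row at time `x` that is not nested with every other row. -/
def Unnested (A : ι → ℤ → WithBot (WithTop Q)) (R : ℤ → Finset ι) (x : ℤ) (i : ι) : Prop :=
  i ∈ R x ∧ ∃ k ∈ R x, ¬ upRow A R x i ⊆ upRow A R x k ∧ ¬ upRow A R x k ⊆ upRow A R x i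

/-- An unnested row that is maximal with respect to inclusion. -/
def MaxUnnested (A : ι → ℤ → WithBot (WithTop Q)) (R : ℤ → Finset ι) (x : ℤ) (i : ι) : Prop :=
  Unnested A R x i ∧ ∀ z, Unnested A R x z → ¬ upRow A R x i ⊂ upRow A R x z

theorem Unnested.exists_max {x : ℤ} {i : ι} (h : Unnested A R x i) :
    ∃ c, MaxUnnested A R x c ∧ upRow A R x i ⊆ upRow A R x c := by
  classical
  obtain ⟨c, hc, hmax⟩ := Finset.exists_max_image
    {c ∈ R x | Unnested A R x c ∧ upRow A R x i ⊆ upRow A R x c}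
    (fun c => (upRow A R x c).card) ⟨i, by simp [h, h.1]⟩
  simp only [Finset.mem_filter] at hc hmax
  refine ⟨c, ⟨hc.2.1, fun z hz hlt => ?_⟩, hc.2.2⟩
  exact absurd (hmax z ⟨hz.1, hz, hc.2.2.trans hlt.subset⟩) (Finset.card_lt_card hlt).not_ge

/-- Used in contrapositive form: a failed inclusion of rows at time `x + 1` forces a comparison
between times `x` and `x + 1`. -/
theorem upRow_subset_of_not_lt (hQ : ThreePlusOneFree Q)
    (hA : ∀ i x, Step (A i x) (A i (x + 1))) {x : ℤ} {y z : ι}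
    (h : ¬ A y x < A z (x + 1)) : upRow A R (x + 1) y ⊆ upRow A R (x + 1) z := by
  intro c hc
  rw [mem_upRow] at *
  exact ⟨hc.1, hQ.lt_of_step (hA y x) h hc.2⟩

variable (hR : ∀ x i, i ∈ R x ↔ A i x < A i (x + 1))

include hR

/-- Rows record only active chains, but an inactive chain stays at `⊥`, above neither entry, or at
`⊤`, above both. -/
theorem upRow_eq_iff (hA : ∀ i x, Step (A i x) (A i (x + 1))) {x : ℤ} {i k : ι} (hi : i ∈ R x)
    (hk : k ∈ R x) (h : upRow A R x i = upRow A R x k) (c : ι) :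
    A i x < A c (x + 1) ↔ A k x < A c (x + 1) := by
  by_cases hc : c ∈ R x
  · have := Finset.ext_iff.1 h c
    simpa [mem_upRow, hc] using this
  · rw [hR] at hi hk hc
    rcases hA c x with h1 | ⟨h1, h2 | h2⟩
    · exact absurd h1 hc
    · rw [← h1, h2]; simp
    · rw [← h1, h2]
      exact ⟨fun _ => hk.trans_le le_top, fun _ => hi.trans_le le_top⟩

/-- A pigeonhole argument. Choose `k` not nested with `i` at time `x + 1`, with the largest possible
row, and let `D` be the chains active at both times whose row at `x + 1` strictly contains that of
`i`. At time `x` the rows of the `D.card + 2` chains in `W` all contain `R x \ D`, so at most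
`D.card + 1` sizes are available. As rows are distinct, two of them are not nested. All of these
rows contain `i`, which gives the inequality. -/
theorem MaxUnnested.exists_pred (hQ : ThreePlusOneFree Q)
    (hA : ∀ i x, Step (A i x) (A i (x + 1)))
    (hN : ∀ x i k, i ∈ R x → k ∈ R x → upRow A R x i = upRow A R x k → i = k)
    {x : ℤ} {i : ι} (hi : MaxUnnested A R (x + 1) i) :
    ∃ c, MaxUnnested A R x c ∧ A c x < A i (x + 1) := by
  classical
  obtain ⟨⟨hiR, k₀, hk₀R, hik₀, hki₀⟩, himax⟩ := hi
  set N := upRow A R x with hNdef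
  set N' := upRow A R (x + 1) with hN'def
  obtain ⟨k, hk, hkmax⟩ := Finset.exists_max_image
    {k ∈ R (x + 1) | ¬ N' i ⊆ N' k ∧ ¬ N' k ⊆ N' i} (fun k => (N' k).card)
    ⟨k₀, by simp [hk₀R, hik₀, hki₀]⟩
  simp only [Finset.mem_filter] at hk hkmax
  obtain ⟨hkR, hik, hki⟩ := hk
  have hsub : ∀ c, N' c ⊆ R (x + 1) := fun c => Finset.filter_subset _ _
  -- A full row is nested with every other, so neither `i` nor `k` is at `⊥` at time `x + 1`; hence
  -- both are already active at time `x`.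
  have hbot : ∀ c, A c (x + 1) = ⊥ → N' c = R (x + 1) := by
    intro c hc
    refine (hsub c).antisymm fun e he => ?_
    rw [hN'def, mem_upRow]
    exact ⟨he, by rw [hc]; exact bot_le.trans_lt ((hR _ _).1 he)⟩
  have hact : ∀ c ∈ R (x + 1), A c (x + 1) ≠ ⊥ → c ∈ R x := by
    intro c hc hcb
    rw [hR] at *
    refine (hA c x).lt_of_ne (fun h => ?_) hcb
    have h2 := (hA c x).le
    rw [h, top_le_iff] at h2
    rw [h2] at hc
    exact not_top_lt hc
  have hib : A i (x + 1) ≠ ⊥ := fun h => hki (by rw [hbot i h]; exact hsub k)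
  have hkb : A k (x + 1) ≠ ⊥ := fun h => hik (by rw [hbot k h]; exact hsub i)
  have hlt : ∀ y z, ¬ N' y ⊆ N' z → A y x < A z (x + 1) := by
    intro y z h
    by_contra h1
    exact h (upRow_subset_of_not_lt hQ hA h1)
  set D := {z ∈ R (x + 1) ∩ R x | N' i ⊂ N' z} with hD
  have hcomp : ∀ c ∈ R (x + 1), c ∈ R x → c ∉ D → ¬ N' i ⊂ N' c := by
    intro c hc hc1 hcD h
    exact hcD (by simp [hD, hc, hc1, h])
  set W := insert i (insert k D) with hW
  have hDmem : ∀ z ∈ D, z ∈ R (x + 1) ∧ z ∈ R x ∧ N' i ⊂ N' z := by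
    intro z hz
    simpa [hD, and_assoc] using hz
  have hWR : ∀ w ∈ W, w ∈ R x := by
    intro w hw
    rw [hW, Finset.mem_insert, Finset.mem_insert] at hw
    rcases hw with rfl | rfl | hw
    · exact hact _ hiR hib
    · exact hact _ hkR hkb
    · exact (hDmem w hw).2.1
  have hWlt : ∀ w ∈ W, A w x < A i (x + 1) := by
    intro w hw
    have hw' := hw
    rw [hW, Finset.mem_insert, Finset.mem_insert] at hw
    rcases hw with rfl | rfl | hw
    · exact (hR _ _).1 (hWR _ hw')
    · exact hlt _ _ hki
    · exact hlt _ _ (hDmem w hw).2.2.not_subset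
  -- If `c ≠ w` is active at both times and missing from the row of `w`, then `N' w ⊆ N' c`. For `w
  -- = i` or `w ∈ D` this forces `c ∈ D`. For `w = k` the case left over is a row larger than `N' k`
  -- and not nested with `N' i`, against the choice of `k`.
  have hconst : ∀ w ∈ W, R x \ D ⊆ N w := by
    intro w hw c hc
    rw [Finset.mem_sdiff] at hc
    rw [hNdef, mem_upRow]
    refine ⟨hc.1, ?_⟩
    by_cases hwc : w = c
    · rw [hwc]; exact (hR _ _).1 hc.1
    have hwR := (hR _ _).1 (hWR w hw)
    by_cases htop : A c (x + 1) = ⊤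
    · rw [htop]; exact hwR.trans_le le_top
    have hcR : c ∈ R (x + 1) := by
      rw [hR]
      refine (hA c (x + 1)).lt_of_ne htop fun h => ?_
      have h1 := (hA c (x + 1)).le
      rw [h, le_bot_iff] at h1
      have h2 := (hR _ _).1 hc.1
      rw [h1] at h2
      exact not_lt_bot h2
    have hcD := hcomp c hcR hc.1 hc.2
    have hic : N' i ⊆ N' c → c = i := by
      intro h
      by_contra hne
      refine hcD (h.ssubset_of_ne fun h2 => hne (hN _ _ _ hiR hcR h2).symm)
    apply hlt
    intro hsub1
    rw [hW, Finset.mem_insert, Finset.mem_insert] at hw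
    rcases hw with rfl | rfl | hw
    · exact hwc (hic hsub1).symm
    · have hss : N' w ⊂ N' c := hsub1.ssubset_of_ne fun h2 => hwc (hN _ _ _ hkR hcR h2)
      by_cases h1 : N' i ⊆ N' c
      · rw [hic h1] at hsub1
        exact hki hsub1
      · by_cases h2 : N' c ⊆ N' i
        · exact hki (hsub1.trans h2)
        · exact absurd (hkmax c ⟨hcR, h1, h2⟩) (Finset.card_lt_card hss).not_ge
    · have h3 := (hDmem w hw).2.2
      have h4 := hic (h3.subset.trans hsub1)
      rw [h4] at hsub1
      exact h3.not_subset hsub1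
  obtain ⟨u, hu, huW⟩ : ∃ u, Unnested A R x u ∧ u ∈ W := by
    by_contra hno
    push Not at hno
    have hnest : ∀ u ∈ W, ∀ v ∈ W, N u ⊆ N v ∨ N v ⊆ N u := by
      intro u hu v hv
      by_contra h
      push Not at h
      exact hno u ⟨hWR u hu, v, hWR v hv, h.1, h.2⟩ hu
    have hinj : Set.InjOn (fun w => (N w).card) (W : Set ι) := by
      intro u hu v hv huv
      refine hN x u v (hWR u hu) (hWR v hv) ?_
      rcases hnest u hu v hv with h | h
      · exact Finset.eq_of_subset_of_card_le h huv.ge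
      · exact (Finset.eq_of_subset_of_card_le h huv.le).symm
    have hmaps : Set.MapsTo (fun w => (N w).card) (W : Set ι)
        (Finset.Icc (R x \ D).card (R x).card : Finset ℕ) := by
      intro w hw
      simp only [Finset.coe_Icc, Set.mem_Icc]
      exact ⟨Finset.card_le_card (hconst w hw), Finset.card_le_card (Finset.filter_subset _ _)⟩
    have h1 := Finset.card_le_card_of_injOn _ hmaps hinj
    have h2 : W.card = D.card + 2 := by
      rw [hW, Finset.card_insert_of_notMem, Finset.card_insert_of_notMem]
      · intro h
        exact hik (hDmem k h).2.2.subset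
      · rw [Finset.mem_insert]
        rintro (rfl | h)
        · exact hik subset_rfl
        · exact (hDmem i h).2.2.not_subset subset_rfl
    have hDR : D ⊆ R x := fun z hz => (hDmem z hz).2.1
    have h3 := Finset.card_sdiff_add_card_eq_card hDR
    rw [Nat.card_Icc] at h1
    omega
  obtain ⟨c, hc, huc⟩ := hu.exists_max
  refine ⟨c, hc, ?_⟩
  have h1 : i ∈ upRow A R x u := by
    rw [mem_upRow]
    exact ⟨hact _ hiR hib, hWlt u huW⟩
  exact (mem_upRow.1 (huc h1)).2

/-- Infinite descent: time has no beginning, but only finitely many values occur, so the entries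
cannot keep decreasing. -/
theorem not_unnested (hQ : ThreePlusOneFree Q)
    (hA : ∀ i x, Step (A i x) (A i (x + 1)))
    (hN : ∀ x i k, i ∈ R x → k ∈ R x → upRow A R x i = upRow A R x k → i = k)
    (hfin : {v | ∃ i x, A i x = v}.Finite) (x : ℤ) (i : ι) : ¬ Unnested A R x i := by
  intro h
  obtain ⟨c, hc, -⟩ := h.exists_max
  set S := {v | ∃ i x, A i x = v ∧ MaxUnnested A R x i} with hS
  have hSfin : S.Finite := hfin.subset fun v ⟨i, x, h, _⟩ => ⟨i, x, h⟩
  obtain ⟨v, hv⟩ := hSfin.exists_minimal ⟨_, c, x, rfl, hc⟩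
  obtain ⟨i, y, rfl, hi⟩ := hv.1
  obtain ⟨y, rfl⟩ : ∃ z, y = z + 1 := ⟨y - 1, by ring⟩
  obtain ⟨e, he, hlt⟩ := hi.exists_pred hR hQ hA hN
  exact (hv.not_lt ⟨e, y, rfl, he⟩) hlt

/-- Distinct nested rows, each containing its own chain, form a staircase with sizes `1, …, (R
x).card`. So `v` lies in the row of `u` exactly when its row is contained in that of `u`, and mutual
membership forces equal rows. -/
theorem eq_of_crossing (hQ : ThreePlusOneFree Q)
    (hA : ∀ i x, Step (A i x) (A i (x + 1)))
    (hN : ∀ x i k, i ∈ R x → k ∈ R x → upRow A R x i = upRow A R x k → i = k)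
    (hfin : {v | ∃ i x, A i x = v}.Finite) {x : ℤ} {i k : ι} (hi : i ∈ R x) (hk : k ∈ R x)
    (hik : A i x < A k (x + 1)) (hki : A k x < A i (x + 1)) : i = k := by
  classical
  set N := upRow A R x with hNdef
  have hnest : ∀ u ∈ R x, ∀ v ∈ R x, N u ⊆ N v ∨ N v ⊆ N u := by
    intro u hu v hv
    by_contra h
    push Not at h
    exact not_unnested hR hQ hA hN hfin x u ⟨hu, v, hv, h.1, h.2⟩
  have hinj : Set.InjOn (fun w => (N w).card) (R x : Set ι) := by
    intro u hu v hv huv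
    refine hN x u v hu hv ?_
    rcases hnest u hu v hv with h | h
    · exact Finset.eq_of_subset_of_card_le h huv.ge
    · exact (Finset.eq_of_subset_of_card_le h huv.le).symm
  -- Otherwise `N y` contains `z` and all of `L`. The rows outside `L` need distinct sizes above `(N
  -- y).card`, and there are too few of these.
  have hmem : ∀ u v, u ∈ R x → v ∈ R x → A u x < A v (x + 1) → N v ⊆ N u := by
    intro y z hy hz hyz
    by_contra hcon
    set L := {u ∈ R x | N u ⊆ N y} with hL
    have h1 : insert z L ⊆ N y := by
      intro u hu
      rw [Finset.mem_insert] at hu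
      rcases hu with rfl | hu
      · exact mem_upRow.2 ⟨hz, hyz⟩
      · rw [hL, Finset.mem_filter] at hu
        exact hu.2 (mem_upRow.2 ⟨hu.1, (hR _ _).1 hu.1⟩)
    have hzL : z ∉ L := by
      intro h
      exact hcon (Finset.mem_filter.1 h).2
    have h2 := Finset.card_le_card h1
    rw [Finset.card_insert_of_notMem hzL] at h2
    have hmaps : Set.MapsTo (fun w => (N w).card) ((R x \ L : Finset ι) : Set ι)
        (Finset.Ioc (N y).card (R x).card : Finset ℕ) := by
      intro w hw
      rw [Finset.mem_coe, Finset.mem_sdiff] at hw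
      simp only [Finset.coe_Ioc, Set.mem_Ioc]
      refine ⟨Finset.card_lt_card ?_, Finset.card_le_card (Finset.filter_subset _ _)⟩
      have hwy : ¬ N w ⊆ N y := fun h => hw.2 (Finset.mem_filter.2 ⟨hw.1, h⟩)
      rcases hnest w hw.1 y hy with h | h
      · exact absurd h hwy
      · exact ⟨h, hwy⟩
    have h3 := Finset.card_le_card_of_injOn _ hmaps
      (hinj.mono fun w hw => (Finset.mem_sdiff.1 hw).1)
    have h4 := Finset.card_sdiff_add_card_eq_card (Finset.filter_subset (fun u => N u ⊆ N y) (R x))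
    rw [← hL] at h4
    have h5 : (N y).card ≤ (R x).card := Finset.card_le_card (Finset.filter_subset _ _)
    rw [Nat.card_Ioc] at h3
    omega
  exact hN x i k hi hk ((hmem k i hk hi hki).antisymm (hmem i k hi hk hik))

end System

end Core

/-! ### Chains as functions of integer time -/

section Strand

variable {Q : Type*} [PartialOrder Q]

/-- The chain `L`, as a function of time that starts at time `b` and is padded by `⊥` and `⊤`. -/
noncomputable def strand (b : ℤ) (L : List Q) (x : ℤ) : WithBot (WithTop Q) :=
  if x < b then ⊥ else ((L[(x - b).toNat]?.elim ⊤ (fun q => (q : WithTop Q)) : WithTop Q) :)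

theorem strand_add (b : ℤ) (L : List Q) (n : ℕ) : strand b L (b + n) =
    ((L[n]?.elim ⊤ (fun q => (q : WithTop Q)) : WithTop Q) : WithBot (WithTop Q)) := by
  rw [strand, if_neg (by omega)]
  simp

theorem strand_of_lt {b : ℤ} {L : List Q} {x : ℤ} (h : x < b) : strand b L x = ⊥ := if_pos h

theorem strand_getElem (b : ℤ) (L : List Q) (n : ℕ) (h : n < L.length) :
    strand b L (b + n) = ((L[n] : WithTop Q) : WithBot (WithTop Q)) := by
  rw [strand_add, List.getElem?_eq_getElem h]
  rfl

theorem strand_eq_bot {b : ℤ} {L : List Q} {x : ℤ} : strand b L x = ⊥ ↔ x < b := by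
  rw [strand]
  split_ifs with h
  · simp [h]
  · simp [h]

theorem strand_eq_top {b : ℤ} {L : List Q} {x : ℤ} : strand b L x = ⊤ ↔ b + L.length ≤ x := by
  rcases lt_or_ge x b with h | h
  · rw [strand_of_lt h]
    constructor
    · intro h1; simp at h1
    · intro h1; omega
  · obtain ⟨n, rfl⟩ := Int.le.dest h
    rw [strand_add]
    rcases lt_or_ge n L.length with h1 | h1
    · rw [List.getElem?_eq_getElem h1]
      constructor
      · intro h2
        exact absurd (WithBot.coe_injective h2) WithTop.coe_ne_top
      · intro h2; omega
    · rw [List.getElem?_eq_none h1]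
      constructor
      · intro h2; omega
      · intro h2; rfl

theorem strand_injective (b : ℤ) : Function.Injective (strand (Q := Q) b) := by
  intro L L' h
  refine List.ext_getElem? fun n => ?_
  have h1 := congrFun h (b + n)
  rw [strand_add, strand_add, WithBot.coe_inj] at h1
  cases h2 : L[n]? <;> cases h3 : L'[n]? <;> simp_all

theorem strand_step {b : ℤ} {L : List Q} (hL : L.IsChain (· < ·)) (x : ℤ) :
    Step (strand b L x) (strand b L (x + 1)) := by
  rcases lt_or_ge x b with h | h
  · rw [strand_of_lt h]
    by_cases h1 : strand b L (x + 1) = ⊥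
    · exact Or.inr ⟨h1.symm, Or.inl rfl⟩
    · exact Or.inl (bot_lt_iff_ne_bot.2 h1)
  · rcases le_or_gt (b + L.length) x with h1 | h1
    · rw [strand_eq_top.2 h1, strand_eq_top.2 (by omega)]
      exact Or.inr ⟨rfl, Or.inr rfl⟩
    · obtain ⟨n, rfl⟩ := Int.le.dest h
      have hn : n < L.length := by omega
      left
      rw [strand_getElem _ _ _ hn]
      rcases lt_or_ge (n + 1) L.length with h2 | h2
      · rw [show b + (n : ℤ) + 1 = b + (n + 1 : ℕ) by push_cast; ring, strand_getElem _ _ _ h2]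
        rw [WithBot.coe_lt_coe, WithTop.coe_lt_coe]
        exact List.isChain_iff_getElem.1 hL n h2
      · rw [strand_eq_top.2 (by omega), ← WithBot.coe_top, WithBot.coe_lt_coe]
        exact WithTop.coe_lt_top _

theorem isChain_of_strand {b : ℤ} {L : List Q}
    (h : ∀ n : ℕ, n + 1 < L.length → strand b L (b + n) < strand b L (b + n + 1)) :
    L.IsChain (· < ·) := by
  rw [List.isChain_iff_getElem]
  intro n hn
  have h1 := h n hn
  rw [show b + (n : ℤ) + 1 = b + (n + 1 : ℕ) by push_cast; ring, strand_getElem _ _ _ hn,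
    strand_getElem _ _ _ (by omega), WithBot.coe_lt_coe, WithTop.coe_lt_coe] at h1
  exact h1

/-- These are the admissible cut times: a cut after `b - 1` moves the whole chain, one after `b +
L.length - 1` an empty tail. -/
theorem strand_active {b : ℤ} {L : List Q} (hL : L.IsChain (· < ·)) {x : ℤ} :
    strand b L x < strand b L (x + 1) ↔ b ≤ x + 1 ∧ x < b + L.length := by
  constructor
  · intro h
    constructor
    · by_contra h1
      rw [strand_of_lt (x := x + 1) (by omega)] at h
      exact not_lt_bot h
    · by_contra h1
      rw [strand_eq_top.2 (by omega)] at h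
      exact not_top_lt h
  · rintro ⟨h1, h2⟩
    refine (strand_step hL x).lt_of_ne (fun h => ?_) fun h => ?_
    · rw [strand_eq_top] at h; omega
    · rw [strand_eq_bot] at h; omega

theorem strand_mono {b : ℤ} {L : List Q} (hL : L.IsChain (· < ·)) : Monotone (strand b L) :=
  monotone_int_of_le_succ fun x => (strand_step hL x).le

/-- Splicing the tail of `L'` after position `v` to the head of `L` before position `u`. -/
theorem strand_take_append_drop (b b' : ℤ) (L L' : List Q) (u v : ℕ) (hu : u ≤ L.length) (x : ℤ) :
    strand b (L.take u ++ L'.drop v) x =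
      if b + u ≤ x then strand b' L' (x - (b + u) + (b' + v)) else strand b L x := by
  rcases lt_or_ge x b with h | h
  · rw [strand_of_lt h, if_neg (by omega), strand_of_lt h]
  · obtain ⟨n, rfl⟩ := Int.le.dest h
    have hlen : (L.take u).length = u := by simp [hu]
    split_ifs with h1
    · obtain ⟨k, rfl⟩ : ∃ k, n = u + k := ⟨n - u, by omega⟩
      rw [show b + ((u + k : ℕ) : ℤ) - (b + u) + (b' + v) = b' + ((v + k : ℕ) : ℤ) by
        push_cast; ring, strand_add, strand_add, List.getElem?_append_right (by omega), hlen,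
        List.getElem?_drop, Nat.add_sub_cancel_left]
    · rw [strand_add, strand_add, List.getElem?_append_left (by omega),
        List.getElem?_take_of_lt (by omega)]

end Strand

/-! ### Arrays of chains on a cylinder -/

section Arrays

variable {Q : Type*} [PartialOrder Q] {l : ℕ}

/-- The entry of the chain with index `p.2` at time `p.1`. -/
noncomputable def entry (b : Fin l → ℤ) (C : Fin l → List Q) (p : ℤ × Fin l) :
    WithBot (WithTop Q) :=
  strand (b p.2) (C p.2) p.1

/-- The point one time step later. -/
def next (p : ℤ × Fin l) : ℤ × Fin l := (p.1 + 1, p.2)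

/-- Two points of an array whose tails can be exchanged because exactly the same entries of the
next level lie above them. -/
structure BadPair (N : ℤ) (b : Fin l → ℤ) (C : Fin l → List Q) (p q : ℤ × Fin l) : Prop where
  ne : p ≠ q
  modEq : p.1 ≡ q.1 [ZMOD N]
  left : entry b C p < entry b C (next p)
  right : entry b C q < entry b C (next q)
  row : ∀ r : ℤ × Fin l, r.1 ≡ p.1 + 1 [ZMOD N] → (entry b C p < entry b C r ↔
    entry b C q < entry b C r)

variable {N : ℤ} {b : Fin l → ℤ} {C : Fin l → List Q} {p q : ℤ × Fin l}

theorem BadPair.symm (h : BadPair N b C p q) : BadPair N b C q p where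
  ne := h.ne.symm
  modEq := h.modEq.symm
  left := h.right
  right := h.left
  row r hr := (h.row r (hr.trans ((h.modEq.symm).add_right 1))).symm

theorem BadPair.trans {r : ℤ × Fin l} (h : BadPair N b C p q) (h' : BadPair N b C q r)
    (hne : p ≠ r) : BadPair N b C p r where
  ne := hne
  modEq := h.modEq.trans h'.modEq
  left := h.left
  right := h'.right
  row s hs := (h.row s hs).trans (h'.row s (hs.trans ((h.modEq).add_right 1)))

/-- On a single chain, the successor of the earlier point lies above that point but not above the
later one. -/
theorem BadPair.snd_ne (hC : ∀ j, (C j).IsChain (· < ·)) (h : BadPair N b C p q) :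
    p.2 ≠ q.2 := by
  intro h2
  have key : ∀ p q : ℤ × Fin l, BadPair N b C p q → p.2 = q.2 → ¬ p.1 < q.1 := by
    intro p q h h2 h1
    have h3 := (h.row (next p) (Int.ModEq.refl _)).1 h.left
    refine absurd h3 (not_lt_of_ge ?_)
    simp only [entry, next, h2]
    exact strand_mono (hC _) (by omega)
  rcases lt_trichotomy p.1 q.1 with h1 | h1 | h1
  · exact key p q h h2 h1
  · exact h.ne (Prod.ext h1 h2)
  · exact key q p h.symm h2.symm h1

/-- The pair of points selected for the exchange of tails. -/
structure Selected (N : ℤ) (b : Fin l → ℤ) (C : Fin l → List Q) (p q : ℤ × Fin l) : Prop where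
  bad : BadPair N b C p q
  fst_min : ∀ p' q', BadPair N b C p' q' → toLex p ≤ toLex p'
  snd_min : ∀ q', BadPair N b C p q' → toLex q ≤ toLex q'

theorem Selected.unique {p' q' : ℤ × Fin l} (h : Selected N b C p q) (h' : Selected N b C p' q') :
    p = p' ∧ q = q' := by
  have h1 : p = p' := toLex.injective
    ((h.fst_min _ _ h'.bad).antisymm (h'.fst_min _ _ h.bad))
  subst h1
  exact ⟨rfl, toLex.injective ((h.snd_min _ h'.bad).antisymm (h'.snd_min _ h.bad))⟩

theorem Selected.fst_le (h : Selected N b C p q) : p.1 ≤ q.1 := by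
  have h1 := h.fst_min _ _ h.bad.symm
  rw [Prod.Lex.toLex_le_toLex] at h1
  rcases h1 with h1 | h1
  · exact h1.le
  · exact h1.1.le

theorem active_finite (hC : ∀ j, (C j).IsChain (· < ·)) :
    {p : ℤ × Fin l | entry b C p < entry b C (next p)}.Finite := by
  refine (Set.finite_iUnion (f := fun j : Fin l =>
    (Set.Icc (b j - 1) (b j + (C j).length)) ×ˢ ({j} : Set (Fin l)))
    (fun j => (Set.finite_Icc _ _).prod (Set.finite_singleton j))).subset ?_
  rintro ⟨x, j⟩ h
  simp only [Set.mem_ofPred_eq, entry, next, strand_active (hC j)] at h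
  simp only [Set.mem_iUnion, Set.mem_prod, Set.mem_Icc, Set.mem_singleton_iff]
  exact ⟨j, ⟨by omega, by omega⟩, rfl⟩

theorem BadPair.exists_selected (hC : ∀ j, (C j).IsChain (· < ·)) (h : BadPair N b C p q) :
    ∃ p q, Selected N b C p q := by
  have hfin := active_finite (b := b) hC
  obtain ⟨p₀, ⟨q₀, h₀⟩, hmin⟩ := Set.exists_min_image {p | ∃ q, BadPair N b C p q} toLex
    (hfin.subset fun p ⟨q, h⟩ => h.left) ⟨p, q, h⟩
  obtain ⟨q₁, h₁, hmin'⟩ := Set.exists_min_image {q | BadPair N b C p₀ q} toLex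
    (hfin.subset fun q h => h.right) ⟨q₀, h₀⟩
  exact ⟨p₀, q₁, h₁, fun p' q' h' => hmin p' ⟨q', h'⟩, hmin'⟩

/-- The array obtained by exchanging the tails after the points `p` and `q`. -/
def swapTails (b : Fin l → ℤ) (p q : ℤ × Fin l) (C : Fin l → List Q) (i : Fin l) : List Q :=
  if i = p.2 then (C p.2).take (p.1 + 1 - b p.2).toNat ++ (C q.2).drop (q.1 + 1 - b q.2).toNat
  else if i = q.2 then
    (C q.2).take (q.1 + 1 - b q.2).toNat ++ (C p.2).drop (p.1 + 1 - b p.2).toNat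
  else C i

/-- The relabelling of points that corresponds to an exchange of tails. -/
def relabel (p q r : ℤ × Fin l) : ℤ × Fin l :=
  if r.2 = p.2 ∧ p.1 < r.1 then (r.1 - p.1 + q.1, q.2)
  else if r.2 = q.2 ∧ q.1 < r.1 then (r.1 - q.1 + p.1, p.2)
  else r

theorem relabel_relabel (h : p.2 ≠ q.2) (r : ℤ × Fin l) : relabel p q (relabel p q r) = r := by
  unfold relabel
  by_cases h1 : r.2 = p.2 ∧ p.1 < r.1
  · rw [if_pos h1, if_neg (by simp [h.symm]), if_pos (by dsimp only; exact ⟨rfl, by omega⟩)]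
    exact Prod.ext (by dsimp only; ring) h1.1.symm
  · rw [if_neg h1]
    by_cases h2 : r.2 = q.2 ∧ q.1 < r.1
    · rw [if_pos h2, if_pos (by dsimp only; exact ⟨rfl, by omega⟩)]
      exact Prod.ext (by dsimp only; ring) h2.1.symm
    · rw [if_neg h2, if_neg h1, if_neg h2]

theorem relabel_modEq (h : p.1 ≡ q.1 [ZMOD N]) (r : ℤ × Fin l) :
    (relabel p q r).1 ≡ r.1 [ZMOD N] := by
  unfold relabel
  split_ifs
  · have := (Int.ModEq.refl (n := N) (r.1 - p.1)).add h.symm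
    simpa using this
  · have := (Int.ModEq.refl (n := N) (r.1 - q.1)).add h
    simpa using this
  · exact Int.ModEq.refl _

theorem relabel_left (h : p.2 ≠ q.2) : relabel p q p = p := by
  simp [relabel, h]

theorem relabel_right (h : p.2 ≠ q.2) : relabel p q q = q := by
  simp [relabel, h.symm]

theorem relabel_next_left : relabel p q (next p) = next q := by
  rw [relabel, if_pos (by simp [next])]
  exact Prod.ext (by simp only [next]; ring) rfl

theorem relabel_next_right (h : p.2 ≠ q.2) : relabel p q (next q) = next p := by
  rw [relabel, if_neg (by simp [next, h.symm]), if_pos (by simp [next])]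
  exact Prod.ext (by simp only [next]; ring) rfl

theorem relabel_next {r : ℤ × Fin l} (h1 : r ≠ p) (h2 : r ≠ q) :
    relabel p q (next r) = next (relabel p q r) := by
  have h3 : (r.2 = p.2 ∧ p.1 < r.1 + 1) ↔ (r.2 = p.2 ∧ p.1 < r.1) := by
    constructor
    · rintro ⟨h, h'⟩
      refine ⟨h, lt_of_le_of_ne (by omega) fun h'' => h1 (Prod.ext h''.symm h)⟩
    · rintro ⟨h, h'⟩
      exact ⟨h, by omega⟩
  have h4 : (r.2 = q.2 ∧ q.1 < r.1 + 1) ↔ (r.2 = q.2 ∧ q.1 < r.1) := by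
    constructor
    · rintro ⟨h, h'⟩
      refine ⟨h, lt_of_le_of_ne (by omega) fun h'' => h2 (Prod.ext h''.symm h)⟩
    · rintro ⟨h, h'⟩
      exact ⟨h, by omega⟩
  simp only [relabel, next, h3, h4]
  split_ifs
  · exact Prod.ext (by dsimp only; ring) rfl
  · exact Prod.ext (by dsimp only; ring) rfl
  · rfl

/-- An exchange of tails only renames points, so statements about the new array pull back to the old
one. -/
theorem entry_swapTails (hC : ∀ j, (C j).IsChain (· < ·)) (h : BadPair N b C p q)
    (r : ℤ × Fin l) : entry b (swapTails b p q C) r = entry b C (relabel p q r) := by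
  have hpq := h.snd_ne hC
  have hp := h.left
  have hq := h.right
  simp only [entry, next] at hp hq
  rw [strand_active (hC _)] at hp hq
  rcases r with ⟨x, i⟩
  simp only [entry, swapTails, relabel]
  by_cases h1 : i = p.2
  · subst h1
    rw [if_pos rfl, strand_take_append_drop (b p.2) (b q.2) _ _ _ _ (by omega)]
    by_cases h2 : p.1 < x
    · rw [if_pos (by omega), if_pos ⟨rfl, h2⟩]
      congr 1
      omega
    · rw [if_neg (by omega), if_neg (by simp [h2]), if_neg (by simp [hpq])]
  · rw [if_neg h1]
    by_cases h3 : i = q.2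
    · subst h3
      rw [if_pos rfl, strand_take_append_drop (b q.2) (b p.2) _ _ _ _ (by omega),
        if_neg (c := q.2 = p.2 ∧ p.1 < x) (by simp [h1])]
      by_cases h2 : q.1 < x
      · rw [if_pos (by omega), if_pos ⟨rfl, h2⟩]
        congr 1
        omega
      · rw [if_neg (by omega), if_neg (by simp [h2])]
    · rw [if_neg h3, if_neg (by simp [h1]), if_neg (by simp [h3])]

/-- Successors change only at the two cut points, and there equality of rows puts the new successor
above. -/
theorem active_swapTails (hC : ∀ j, (C j).IsChain (· < ·)) (h : BadPair N b C p q)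
    (r : ℤ × Fin l) :
    entry b (swapTails b p q C) r < entry b (swapTails b p q C) (next r) ↔
      entry b C (relabel p q r) < entry b C (next (relabel p q r)) := by
  have hpq := h.snd_ne hC
  rw [entry_swapTails hC h, entry_swapTails hC h]
  by_cases h1 : r = p
  · subst h1
    rw [relabel_left hpq, relabel_next_left]
    have := (h.row (next q) (h.modEq.symm.add_right 1)).2 h.right
    simp only [this, h.left]
  · by_cases h2 : r = q
    · subst h2
      rw [relabel_right hpq, relabel_next_right hpq]
      have := (h.row (next p) (Int.ModEq.refl _)).1 h.left
      simp only [this, h.right]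
    · rw [relabel_next h1 h2]

/-- Relabelling preserves times modulo `N`, so it permutes the points of each level. -/
theorem badPair_swapTails (hC : ∀ j, (C j).IsChain (· < ·)) (h : BadPair N b C p q)
    {r s : ℤ × Fin l} (hrs : BadPair N b C (relabel p q r) (relabel p q s)) :
    BadPair N b (swapTails b p q C) r s where
  ne e := hrs.ne (by rw [e])
  modEq := ((relabel_modEq h.modEq r).symm.trans hrs.modEq).trans (relabel_modEq h.modEq s)
  left := (active_swapTails hC h r).2 hrs.left
  right := (active_swapTails hC h s).2 hrs.right
  row t ht := by
    simp only [entry_swapTails hC h]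
    exact hrs.row _ ((relabel_modEq h.modEq t).trans
      (ht.trans ((relabel_modEq h.modEq r).symm.add_right 1)))

theorem badPair_swapTails_self (hC : ∀ j, (C j).IsChain (· < ·)) (h : BadPair N b C p q) :
    BadPair N b (swapTails b p q C) p q :=
  badPair_swapTails hC h (by rw [relabel_left (h.snd_ne hC), relabel_right (h.snd_ne hC)]; exact h)

theorem isChain_swapTails (hC : ∀ j, (C j).IsChain (· < ·)) (h : BadPair N b C p q) (i : Fin l) :
    (swapTails b p q C i).IsChain (· < ·) := by
  refine isChain_of_strand (b := b i) fun n hn => ?_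
  refine (active_swapTails hC h (b i + n, i)).2 ?_
  have hlt : entry b (swapTails b p q C) (b i + n, i) ≠ ⊤ := by
    simp only [entry, ne_eq, strand_eq_top]
    omega
  have hbot : entry b (swapTails b p q C) (b i + n, i) ≠ ⊥ := by
    simp only [entry, ne_eq, strand_eq_bot]
    omega
  rw [entry_swapTails hC h] at hlt hbot
  simp only [entry, next, ne_eq, strand_eq_top, strand_eq_bot] at hlt hbot ⊢
  rw [strand_active (hC _)]
  omega

theorem swapTails_swapTails (hC : ∀ j, (C j).IsChain (· < ·)) (h : BadPair N b C p q) :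
    swapTails b p q (swapTails b p q C) = C := by
  funext i
  refine strand_injective (b i) (funext fun x => ?_)
  have h1 := entry_swapTails (isChain_swapTails hC h) (badPair_swapTails_self hC h) (x, i)
  rw [entry_swapTails hC h, relabel_relabel (h.snd_ne hC)] at h1
  exact h1

/-- This makes the exchange an involution. Points lexicographically before `p` have time at most
`p.1 ≤ q.1`, so `relabel` fixes them. A new partner of `p` that `relabel` moves would give a bad
pair on a single chain. -/
theorem Selected.swapTails (hC : ∀ j, (C j).IsChain (· < ·)) (h : Selected N b C p q) :
    Selected N b (swapTails b p q C) p q := by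
  have hpq := h.bad.snd_ne hC
  have hback : ∀ {r s}, BadPair N b (CylP.swapTails b p q C) r s →
      BadPair N b C (relabel p q r) (relabel p q s) := by
    intro r s hrs
    have h1 := badPair_swapTails (isChain_swapTails hC h.bad) (badPair_swapTails_self hC h.bad)
      (r := relabel p q r) (s := relabel p q s)
      (by rw [relabel_relabel hpq, relabel_relabel hpq]; exact hrs)
    rwa [swapTails_swapTails hC h.bad] at h1
  refine ⟨badPair_swapTails_self hC h.bad, fun p' q' h' => ?_, fun q' h' => ?_⟩
  · have h1 := h.fst_min _ _ (hback h')
    by_contra hcon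
    rw [not_le, Prod.Lex.toLex_lt_toLex] at hcon
    have hle := h.fst_le
    have h2 : p'.1 ≤ p.1 := by
      rcases hcon with h2 | h2
      · exact h2.le
      · exact h2.1.le
    rw [relabel, if_neg (by omega), if_neg (by omega)] at h1
    rw [← not_lt] at h1
    exact h1 (Prod.Lex.toLex_lt_toLex.2 hcon)
  · have h1 := hback h'
    rw [relabel_left hpq] at h1
    by_cases hq' : relabel p q q' = q'
    · rw [hq'] at h1
      exact h.snd_min _ h1
    · exfalso
      unfold relabel at h1 hq'
      split_ifs at h1 hq' with h2 h3
      · refine (h.bad.symm.trans h1 ?_).snd_ne hC rfl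
        intro h4
        have := congrArg Prod.fst h4
        dsimp only at this
        omega
      · exact h1.snd_ne hC rfl
      · exact hq' rfl

theorem swapTails_perm (hpq : p.2 ≠ q.2) :
    ∑ i, (↑(swapTails b p q C i) : Multiset Q) = ∑ i, (↑(C i) : Multiset Q) := by
  rw [← Finset.add_sum_erase _ _ (Finset.mem_univ p.2),
    ← Finset.add_sum_erase (a := q.2) _ _ (by simp [hpq.symm]),
    ← Finset.add_sum_erase _ (fun i => (↑(C i) : Multiset Q)) (Finset.mem_univ p.2),
    ← Finset.add_sum_erase (a := q.2) _ (fun i => (↑(C i) : Multiset Q)) (by simp [hpq.symm]),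
    ← add_assoc, ← add_assoc]
  congr 1
  · conv_rhs => rw [← List.take_append_drop (p.1 + 1 - b p.2).toNat (C p.2),
      ← List.take_append_drop (q.1 + 1 - b q.2).toNat (C q.2)]
    simp only [swapTails, if_true, if_neg hpq.symm, ← Multiset.coe_add]
    abel
  · refine Finset.sum_congr rfl fun i hi => ?_
    simp only [Finset.mem_erase] at hi
    simp [swapTails, hi.1, hi.2.1]

end Arrays

/-! ### Flawless arrays on the cylinder -/

section Cylinder

variable {Q : Type*} [PartialOrder Q] {l : ℕ}

theorem finite_range_strand (b : ℤ) (L : List Q) : (Set.range (strand b L)).Finite := by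
  refine (((Set.finite_range fun n : Fin L.length =>
    ((L[n] : WithTop Q) : WithBot (WithTop Q))).insert ⊤).insert ⊥).subset ?_
  rintro _ ⟨x, rfl⟩
  by_cases h1 : strand b L x = ⊥
  · exact Or.inl h1
  · by_cases h2 : strand b L x = ⊤
    · exact Or.inr (Or.inl h2)
    · rw [strand_eq_bot, not_lt] at h1
      rw [strand_eq_top] at h2
      obtain ⟨n, rfl⟩ := Int.le.dest h1
      exact Or.inr (Or.inr ⟨⟨n, by omega⟩, (strand_getElem b L n (by omega)).symm⟩)

/-- Unroll the cylinder: index `(i, m)` stands for chain `i` shifted by `m` periods, so congruent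
times become equal. Only finitely many shifts are active at a given time, and two equal rows would
be a bad pair. -/
theorem eq_of_crossing_of_not_badPair (hQ : ThreePlusOneFree Q) {N : ℤ} (hN : 0 < N)
    {b : Fin l → ℤ} {C : Fin l → List Q} (hC : ∀ j, (C j).IsChain (· < ·))
    (hbad : ∀ p q, ¬ BadPair N b C p q) {p q : ℤ × Fin l} (hpq : p.1 ≡ q.1 [ZMOD N])
    (hp : entry b C p < entry b C (next p)) (hq : entry b C q < entry b C (next q))
    (h : entry b C p < entry b C (next q)) (h' : entry b C q < entry b C (next p)) : p = q := by
  classical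
  set A : Fin l × ℤ → ℤ → WithBot (WithTop Q) := fun c x => entry b C (x + c.2 * N, c.1) with hAdef
  have hnext : ∀ c x, A c (x + 1) = entry b C (next (x + c.2 * N, c.1)) := by
    intro c x
    simp only [hAdef, next]
    congr 2
    ring
  have hA : ∀ c x, Step (A c x) (A c (x + 1)) := by
    intro c x
    rw [hnext]
    exact strand_step (hC _) _
  have hRfin : ∀ x, {c | A c x < A c (x + 1)}.Finite := by
    intro x
    refine Set.Finite.preimage (f := fun c : Fin l × ℤ => ((x + c.2 * N, c.1) : ℤ × Fin l)) ?_
      (active_finite (b := b) hC) |>.subset ?_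
    · rintro ⟨i, m⟩ - ⟨j, n⟩ - hij
      simp only [Prod.mk.injEq, add_right_inj, mul_eq_mul_right_iff, hN.ne', or_false] at hij
      exact Prod.ext hij.2 hij.1
    · intro c hc
      simp only [Set.mem_preimage, Set.mem_ofPred_eq] at hc ⊢
      rwa [← hnext]
  set R : ℤ → Finset (Fin l × ℤ) := fun x => (hRfin x).toFinset with hRdef
  have hR : ∀ x i, i ∈ R x ↔ A i x < A i (x + 1) := by
    intro x i
    simp [hRdef]
  have hfin : {v | ∃ i x, A i x = v}.Finite := by
    refine (Set.finite_iUnion fun j => finite_range_strand (b j) (C j)).subset ?_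
    rintro _ ⟨i, x, rfl⟩
    exact Set.mem_iUnion.2 ⟨i.1, _, rfl⟩
  have hinj : ∀ x i k, i ∈ R x → k ∈ R x → upRow A R x i = upRow A R x k → i = k := by
    intro x i k hi hk hik
    by_contra hne
    refine hbad (x + i.2 * N, i.1) (x + k.2 * N, k.1) ⟨?_, ?_, ?_, ?_, ?_⟩
    · intro h
      simp only [Prod.mk.injEq, add_right_inj, mul_eq_mul_right_iff, hN.ne', or_false] at h
      exact hne (Prod.ext h.2 h.1)
    · rw [Int.modEq_iff_dvd]
      exact ⟨k.2 - i.2, by ring⟩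
    · rw [← hnext]; exact (hR _ _).1 hi
    · rw [← hnext]; exact (hR _ _).1 hk
    · rintro ⟨y, j⟩ hr
      obtain ⟨m, hm⟩ := Int.modEq_iff_dvd.1 hr.symm
      have h1 := upRow_eq_iff hR hA hi hk hik (j, m + i.2)
      have h2 : A (j, m + i.2) (x + 1) = entry b C (y, j) := by
        simp only [hAdef]
        congr 2
        dsimp only at hm
        linear_combination -hm
      rw [h2] at h1
      exact h1
  obtain ⟨m, hm⟩ := Int.modEq_iff_dvd.1 hpq
  have hp' : (p.1 + ((p.2, (0 : ℤ)) : Fin l × ℤ).2 * N, p.2) = p := Prod.ext (by simp) rfl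
  have hq' : (p.1 + ((q.2, m) : Fin l × ℤ).2 * N, q.2) = q :=
    Prod.ext (by dsimp only; linear_combination -hm) rfl
  have e1 : A (p.2, 0) p.1 = entry b C p := by simp only [hAdef]; rw [hp']
  have e2 : A (q.2, m) p.1 = entry b C q := by simp only [hAdef]; rw [hq']
  have e3 : A (p.2, 0) (p.1 + 1) = entry b C (next p) := by rw [hnext, hp']
  have e4 : A (q.2, m) (p.1 + 1) = entry b C (next q) := by rw [hnext, hq']
  have := eq_of_crossing (i := (p.2, 0)) (k := (q.2, m)) (x := p.1) hR hQ hA hinj hfin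
    (by rw [hR, e1, e3]; exact hp) (by rw [hR, e2, e4]; exact hq)
    (by rw [e1, e4]; exact h) (by rw [e2, e3]; exact h')
  rw [Prod.mk.injEq] at this
  refine Prod.ext ?_ this.1
  rw [← this.2] at hm
  linarith

/-- The index, on the cylinder, of the `n`-th column of its universal cover. -/
def wrap (hl : 0 < l) (n : ℕ) : Fin l := ⟨n % l, Nat.mod_lt n hl⟩

/-- The point, on the cylinder, of the `n`-th column of its universal cover at time `x`. -/
def cover (hl : 0 < l) (N : ℤ) (n : ℕ) (x : ℤ) : ℤ × Fin l := (x + (n / l : ℕ) * N, wrap hl n)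

theorem cover_add_one (hl : 0 < l) (N : ℤ) (n : ℕ) (x : ℤ) :
    cover hl N n (x + 1) = next (cover hl N n x) :=
  Prod.ext (by simp only [cover, next]; ring) rfl

theorem wrap_succ (hl : 0 < l) (n : ℕ) :
    ((wrap hl n : ℕ) + 1 < l ∧ (wrap hl (n + 1) : ℕ) = wrap hl n + 1 ∧ (n + 1) / l = n / l) ∨
    ((wrap hl n : ℕ) = l - 1 ∧ (wrap hl (n + 1) : ℕ) = 0 ∧ (n + 1) / l = n / l + 1) := by
  have h1 := Nat.mod_lt n hl
  have h2 := Nat.div_add_mod n l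
  simp only [wrap]
  by_cases h : n % l + 1 < l
  · left
    refine ⟨h, ?_, ?_⟩
    · rw [← h2, add_assoc, Nat.mul_add_mod, Nat.mul_add_mod, Nat.mod_mod, Nat.mod_eq_of_lt h]
    · conv_lhs => rw [← h2, add_assoc, Nat.mul_add_div hl, Nat.div_eq_of_lt h]
      simp
  · right
    have h3 : n % l + 1 = l := by omega
    refine ⟨by omega, ?_, ?_⟩
    · rw [← h2, add_assoc, Nat.mul_add_mod, h3, Nat.mod_self]
    · conv_lhs => rw [← h2, add_assoc, Nat.mul_add_div hl, h3, Nat.div_self hl]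

/-- A sequence of column positions that decreases strictly along the universal cover. -/
def CyclicAnti (N : ℤ) (a : Fin l → ℤ) : Prop :=
  (∀ i j, i < j → a j < a i) ∧ ∀ i j, a i - a j < N

theorem CyclicAnti.cover_lt {N : ℤ} {a : Fin l → ℤ} (h : CyclicAnti N a) (hl : 0 < l) (n : ℕ) :
    a (wrap hl (n + 1)) - ((n + 1) / l : ℕ) * N < a (wrap hl n) - (n / l : ℕ) * N := by
  rcases wrap_succ hl n with ⟨-, h2, h3⟩ | ⟨-, -, h3⟩
  · rw [h3]
    have := h.1 (wrap hl n) (wrap hl (n + 1)) (by rw [Fin.lt_def, h2]; omega)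
    linarith
  · rw [h3]
    have := h.2 (wrap hl (n + 1)) (wrap hl n)
    push_cast
    linarith

/-- No entry of the array is larger than its right neighbor on the cylinder. -/
def Flawless (N : ℤ) (b : Fin l → ℤ) (C : Fin l → List Q) : Prop :=
  ∀ (hl : 0 < l) (n : ℕ) (x : ℤ),
    ¬ entry b C (cover hl N (n + 1) x) < entry b C (cover hl N n (x + 1))

variable {N : ℤ} {b : Fin l → ℤ} {C : Fin l → List Q}

/-- At the earliest flaw between two neighboring columns, the absence of a flaw one step before and
(3+1)-freeness give the opposite comparison as well, so the two chains cross. -/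
theorem flawless_of_not_badPair (hQ : ThreePlusOneFree Q) (hN : 0 < N) (hb : CyclicAnti N b)
    (hC : ∀ j, (C j).IsChain (· < ·)) (hbad : ∀ p q, ¬ BadPair N b C p q) :
    Flawless N b C := by
  intro hl n x₀ hx₀
  have hbot : ∀ x n, entry b C (cover hl N n x) = ⊥ ↔ x < b (wrap hl n) - (n / l : ℕ) * N := by
    intro x n
    simp only [entry, cover, strand_eq_bot]
    constructor <;> intro h <;> linarith
  obtain ⟨x, hx, hmin⟩ := Int.exists_least_of_bdd
    (P := fun x => entry b C (cover hl N (n + 1) x) < entry b C (cover hl N n (x + 1)))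
    ⟨b (wrap hl n) - (n / l : ℕ) * N - 1, fun x hx => by
      by_contra h
      have := (hbot (x + 1) n).2 (by linarith)
      rw [this] at hx
      exact not_lt_bot hx⟩ ⟨x₀, hx₀⟩
  have hprev : ¬ entry b C (cover hl N (n + 1) (x - 1)) < entry b C (cover hl N n x) := by
    intro h
    have := hmin (x - 1) (by rw [sub_add_cancel]; exact h)
    omega
  have hstep : ∀ n x, Step (entry b C (cover hl N n x)) (entry b C (cover hl N n (x + 1))) := by
    intro n x
    rw [cover_add_one]
    exact strand_step (hC _) _
  have hnb : entry b C (cover hl N n (x + 1)) ≠ ⊥ := (bot_le.trans_lt hx).ne'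
  -- By `CyclicAnti`, column `n + 1` starts before column `n`, which has already left `⊥` at time `x
  -- + 1`.
  have hact : entry b C (cover hl N (n + 1) x) < entry b C (cover hl N (n + 1) (x + 1)) := by
    refine (hstep _ _).lt_of_ne (hx.trans_le le_top).ne ?_
    rw [ne_eq, hbot] at hnb ⊢
    have := hb.cover_lt hl n
    linarith
  have hcross : entry b C (cover hl N n x) < entry b C (cover hl N (n + 1) (x + 1)) := by
    refine hQ.lt_of_step ?_ hprev hact
    have := hstep (n + 1) (x - 1)
    rwa [sub_add_cancel] at this
  have hact' : entry b C (cover hl N n x) < entry b C (cover hl N n (x + 1)) :=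
    (hstep _ _).lt_of_ne (hcross.trans_le le_top).ne hnb
  have heq : cover hl N n x = cover hl N (n + 1) x := by
    simp only [cover_add_one] at *
    refine eq_of_crossing_of_not_badPair hQ hN hC hbad ?_ hact' hact hcross hx
    rw [Int.modEq_iff_dvd]
    exact ⟨((n + 1) / l : ℕ) - (n / l : ℕ), by simp only [cover]; ring⟩
  simp only [cover, Prod.mk.injEq, add_right_inj, mul_eq_mul_right_iff, hN.ne', or_false,
    Nat.cast_inj, wrap, Fin.mk.injEq] at heq
  have h1 := Nat.div_add_mod n l
  have h2 := Nat.div_add_mod (n + 1) l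
  rw [← heq.1, ← heq.2] at h2
  omega

/-- By (3+1)-freeness, a comparison between distant columns can be moved one column to the left,
until the columns are adjacent. -/
theorem Flawless.not_lt (hQ : ThreePlusOneFree Q) (hC : ∀ j, (C j).IsChain (· < ·))
    (h : Flawless N b C) (hl : 0 < l) (n m : ℕ) (x : ℤ) :
    ¬ entry b C (cover hl N (n + m + 1) x) < entry b C (cover hl N n (x + 1)) := by
  induction m with
  | zero => exact h hl n x
  | succ m ih =>
    intro hlt
    have h1 := h hl (n + m + 1) (x - 1)
    rw [sub_add_cancel] at h1
    refine ih (hQ.lt_of_step ?_ h1 hlt)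
    have : cover hl N (n + m + 1 + 1) x = next (cover hl N (n + m + 1 + 1) (x - 1)) := by
      rw [← cover_add_one, sub_add_cancel]
    change Step _ (entry b C (cover hl N (n + m + 1 + 1) x))
    rw [this]
    exact strand_step (hC _) _

/-- Lift the two points to the same time in two columns of the cover. Each lies below the successor
of the other, which is forbidden for the point in the right-hand column. -/
theorem Flawless.not_badPair (hQ : ThreePlusOneFree Q) (hC : ∀ j, (C j).IsChain (· < ·))
    (h : Flawless N b C) (p q : ℤ × Fin l) : ¬ BadPair N b C p q := by
  intro hbad
  have key : ∀ p q : ℤ × Fin l, ∀ m : ℕ, BadPair N b C p q → q.1 = p.1 + m * N → False := by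
    intro p q m hbad hm
    have hl : 0 < l := p.2.pos
    have hp : p = cover hl N p.2 p.1 := by
      refine Prod.ext ?_ (Fin.ext ?_)
      · simp [cover, Nat.div_eq_of_lt p.2.2]
      · simp [cover, wrap, Nat.mod_eq_of_lt p.2.2]
    have hq : q = cover hl N (q.2 + m * l) p.1 := by
      refine Prod.ext ?_ (Fin.ext ?_)
      · simp only [cover, hm, Nat.add_mul_div_right _ _ hl, Nat.div_eq_of_lt q.2.2, zero_add]
      · simp [cover, wrap, Nat.mod_eq_of_lt q.2.2]
    have hpq := (hbad.row (next q) (hbad.modEq.symm.add_right 1)).2 hbad.right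
    have hqp := (hbad.row (next p) (Int.ModEq.refl _)).1 hbad.left
    set n := (p.2 : ℕ)
    set n' := (q.2 + m * l : ℕ)
    set x := p.1
    rw [hq, hp, ← cover_add_one] at hpq hqp
    rcases lt_trichotomy n n' with h1 | h1 | h1
    · obtain ⟨k, hk⟩ := Nat.exists_eq_add_of_lt h1
      rw [hk] at hqp
      exact h.not_lt hQ hC hl n k x hqp
    · rw [h1, ← hq] at hp
      exact hbad.ne hp
    · obtain ⟨k, hk⟩ := Nat.exists_eq_add_of_lt h1
      rw [hk] at hpq
      exact h.not_lt hQ hC hl n' k x hpq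
  obtain ⟨m, hm⟩ := Int.modEq_iff_dvd.1 hbad.modEq
  rcases le_total 0 m with h0 | h0
  · refine key p q m.toNat hbad ?_
    rw [Int.toNat_of_nonneg h0]
    linarith
  · refine key q p (-m).toNat hbad.symm ?_
    rw [Int.toNat_of_nonneg (by omega)]
    linarith

/-- If column `n + 1` did not end before column `n`, the first `⊤` of column `n` would exceed its
right neighbor, which is not yet `⊤`. -/
theorem Flawless.cyclicAnti (h : Flawless N b C) :
    CyclicAnti N fun j => b j + (C j).length := by
  have hlt : ∀ (hl : 0 < l) (n : ℕ),
      b (wrap hl (n + 1)) + (C (wrap hl (n + 1))).length - ((n + 1) / l : ℕ) * N <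
        b (wrap hl n) + (C (wrap hl n)).length - (n / l : ℕ) * N := by
    intro hl n
    by_contra hcon
    set x := b (wrap hl n) + (C (wrap hl n)).length - (n / l : ℕ) * N - 1 with hx
    refine h hl n x ?_
    have h1 : entry b C (cover hl N n (x + 1)) = ⊤ := by
      simp only [entry, cover, strand_eq_top]
      linarith
    rw [h1, lt_top_iff_ne_top, ne_eq]
    simp only [entry, cover, strand_eq_top]
    linarith
  have hlt' : ∀ (hl : 0 < l) (n m : ℕ), n < m →
      b (wrap hl m) + (C (wrap hl m)).length - (m / l : ℕ) * N <
        b (wrap hl n) + (C (wrap hl n)).length - (n / l : ℕ) * N := fun hl n m hnm =>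
    strictAnti_nat_of_succ_lt
      (f := fun n => b (wrap hl n) + (C (wrap hl n)).length - (n / l : ℕ) * N) (hlt hl) hnm
  have hw : ∀ (hl : 0 < l) (i : Fin l), wrap hl i = i := fun hl i =>
    Fin.ext (Nat.mod_eq_of_lt i.2)
  have hw' : ∀ (hl : 0 < l) (i : Fin l), wrap hl (i + l) = i := fun hl i =>
    Fin.ext (by simp [wrap, Nat.mod_eq_of_lt i.2])
  refine ⟨fun i j hij => ?_, fun i j => ?_⟩
  · have := hlt' i.pos i j hij
    simpa [hw, Nat.div_eq_of_lt] using this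
  · have := hlt' i.pos j (i + l) (by omega)
    rw [hw, hw', Nat.add_div_right _ i.pos, Nat.div_eq_of_lt i.2, Nat.div_eq_of_lt j.2] at this
    push_cast at this
    linarith

/-- Write `e j = a (σ j) + N * k j`, where the `k j` sum to zero. A positive and a negative `k`
would spread `e` over more than `N`. So `k = 0`, and then `σ` is strictly increasing. -/
theorem CyclicAnti.eq_of_modEq {a e : Fin l → ℤ} (ha : CyclicAnti N a) (he : CyclicAnti N e)
    (σ : Equiv.Perm (Fin l)) (h : ∀ j, e j ≡ a (σ j) [ZMOD N]) (hsum : ∑ j, e j = ∑ j, a j)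
    (hN : 0 < N) : σ = 1 ∧ e = a := by
  choose k hk using fun j => Int.modEq_iff_dvd.1 (h j).symm
  have hk0 : ∀ j, k j = 0 := by
    have hs : ∑ j, k j = 0 := by
      have h1 : N * ∑ j, k j = 0 := by
        rw [Finset.mul_sum, ← Finset.sum_congr rfl fun j _ => hk j, Finset.sum_sub_distrib, hsum,
          Equiv.sum_comp σ a, sub_self]
      rcases mul_eq_zero.1 h1 with h2 | h2
      · exact absurd h2 hN.ne'
      · exact h2
    have key : ∀ i j, 0 < k i → k j < 0 → False := by
      intro i j hi hj
      have h1 := he.2 i j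
      have h2 := ha.2 (σ j) (σ i)
      have h3 := hk i
      have h4 := hk j
      nlinarith
    by_contra hne
    push Not at hne
    obtain ⟨j, hj⟩ := hne
    rcases lt_or_gt_of_ne hj with hj | hj
    · obtain ⟨i, -, hi⟩ := Finset.exists_pos_of_sum_zero_of_exists_nonzero k hs
        ⟨j, Finset.mem_univ j, hj.ne⟩
      exact key i j hi hj
    · have hs' : ∑ j, -k j = 0 := by rw [Finset.sum_neg_distrib, hs, neg_zero]
      obtain ⟨i, -, hi⟩ := Finset.exists_pos_of_sum_zero_of_exists_nonzero (fun j => -k j) hs'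
        ⟨j, Finset.mem_univ j, by simpa using hj.ne'⟩
      exact key j i hj (by simpa using hi)
  have hea : ∀ j, e j = a (σ j) := by
    intro j
    have := hk j
    rw [hk0 j] at this
    linarith
  have hmono : StrictMono σ := by
    intro i j hij
    by_contra hcon
    have h1 : a (σ i) ≤ a (σ j) := by
      rcases (not_lt.1 hcon).lt_or_eq with h2 | h2
      · exact (ha.1 _ _ h2).le
      · rw [h2]
    have h2 := he.1 i j hij
    rw [hea, hea] at h2
    omega
  have hσ : σ = 1 := by
    ext i
    have : (σ : Fin l → Fin l) = id := by
      refine (StrictMono.range_inj hmono strictMono_id).1 ?_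
      rw [Set.range_id, σ.surjective.range_eq]
    simp [this]
  refine ⟨hσ, funext fun j => ?_⟩
  rw [hea, hσ]
  rfl

end Cylinder

/-! ### The sign-reversing involution -/

section SignedCount

variable {Q : Type*} [PartialOrder Q] {l : ℕ}

/-- The arrays of chains with contents `M` whose chains start at `b`, and end at the times `a` up
to a permutation and to multiples of `N`. -/
structure IsArray (N : ℤ) (a b : Fin l → ℤ) (M : Multiset Q)
    (x : Equiv.Perm (Fin l) × (Fin l → List Q)) : Prop where
  chain : ∀ j, (x.2 j).IsChain (· < ·)
  content : ∑ j, (↑(x.2 j) : Multiset Q) = M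
  sum_eq : ∑ j, (b j + (x.2 j).length) = ∑ j, a j
  modEq : ∀ j, b j + (x.2 j).length ≡ a (x.1 j) [ZMOD N]

theorem finite_lists (M : Multiset Q) :
    {C : Fin l → List Q | ∑ j, (↑(C j) : Multiset Q) = M}.Finite := by
  classical
  refine (Set.Finite.pi' (t := fun _ : Fin l => {L : List Q | (↑L : Multiset Q) ≤ M}) fun _ => ?_).subset ?_
  · refine Set.Finite.subset (Set.Finite.biUnion (Set.finite_Iic M)
      (t := fun M' => {L : List Q | (↑L : Multiset Q) = M'}) fun M' _ => ?_) ?_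
    · induction M' using Quotient.inductionOn with
      | h L' =>
        refine (List.finite_toSet L'.permutations).subset fun L hL => ?_
        have : L.Perm L' := Multiset.coe_eq_coe.1 hL
        exact List.mem_permutations.2 this
    · intro L hL
      simp only [Set.mem_iUnion]
      exact ⟨_, hL, rfl⟩
  · intro C hC j
    have hC' : ∑ j, (↑(C j) : Multiset Q) = M := hC
    change (↑(C j) : Multiset Q) ≤ M
    rw [← hC']
    exact Finset.single_le_sum (f := fun j => (↑(C j) : Multiset Q)) (fun _ _ => Multiset.zero_le _)
      (Finset.mem_univ j)

variable {N : ℤ} {a b : Fin l → ℤ} {M : Multiset Q}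

theorem finite_isArray : {x | IsArray N a b M x}.Finite :=
  ((Set.finite_univ (α := Equiv.Perm (Fin l))).prod (finite_lists M)).subset
    fun _ hx => ⟨Set.mem_univ _, hx.content⟩

/-- The new end of chain `p.2` is the old end of chain `q.2` moved by `p.1 - q.1`, a multiple of
`N`. -/
theorem BadPair.length_swapTails {C : Fin l → List Q} {p q : ℤ × Fin l}
    (hC : ∀ j, (C j).IsChain (· < ·)) (h : BadPair N b C p q) (j : Fin l) :
    b j + (swapTails b p q C j).length ≡
      b (Equiv.swap p.2 q.2 j) + (C (Equiv.swap p.2 q.2 j)).length [ZMOD N] := by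
  have hpq := h.snd_ne hC
  have hp := h.left
  have hq := h.right
  simp only [entry, next] at hp hq
  rw [strand_active (hC _)] at hp hq
  by_cases h1 : j = p.2
  · subst h1
    rw [Equiv.swap_apply_left, Int.modEq_iff_dvd]
    obtain ⟨m, hm⟩ := Int.modEq_iff_dvd.1 h.modEq
    refine ⟨m, ?_⟩
    rw [← hm]
    simp only [swapTails, if_true, List.length_append, List.length_take, List.length_drop]
    omega
  · by_cases h2 : j = q.2
    · subst h2
      rw [Equiv.swap_apply_right, Int.modEq_iff_dvd]
      obtain ⟨m, hm⟩ := Int.modEq_iff_dvd.1 h.modEq.symm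
      refine ⟨m, ?_⟩
      rw [← hm]
      simp only [swapTails, if_true, if_neg h1, List.length_append, List.length_take,
        List.length_drop]
      omega
    · rw [Equiv.swap_apply_of_ne_of_ne h1 h2, swapTails, if_neg h1, if_neg h2]

theorem IsArray.swapTails {x : Equiv.Perm (Fin l) × (Fin l → List Q)} {p q : ℤ × Fin l}
    (hx : IsArray N a b M x) (h : BadPair N b x.2 p q) :
    IsArray N a b M (x.1 * Equiv.swap p.2 q.2, swapTails b p q x.2) where
  chain := isChain_swapTails hx.chain h
  content := by rw [← hx.content]; exact swapTails_perm (h.snd_ne hx.chain)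
  sum_eq := by
    rw [← hx.sum_eq, Finset.sum_add_distrib, Finset.sum_add_distrib]
    congr 1
    have := congrArg Multiset.card (swapTails_perm (b := b) (C := x.2) (h.snd_ne hx.chain))
    simp only [Multiset.card_sum, Multiset.coe_card] at this
    exact_mod_cast this
  modEq j := (h.length_swapTails hx.chain j).trans (hx.modEq _)

/-- The signed count of arrays of chains reduces to the flawless arrays. -/
theorem sum_sign_isArray (hQ : ThreePlusOneFree Q) (hN : 0 < l → 0 < N) (ha : CyclicAnti N a)
    (hb : CyclicAnti N b) :
    ∑ x ∈ (finite_isArray (N := N) (a := a) (b := b) (M := M)).toFinset,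
      ((Equiv.Perm.sign x.1 : ℤˣ) : ℤ) =
    Nat.card {C : Fin l → List Q // (∀ j, (C j).IsChain (· < ·)) ∧
      (∀ j, b j + (C j).length = a j) ∧ Flawless N b C ∧ ∑ j, (↑(C j) : Multiset Q) = M} := by
  classical
  set S := (finite_isArray (N := N) (a := a) (b := b) (M := M)).toFinset with hS
  have hmem : ∀ x, x ∈ S ↔ IsArray N a b M x := fun x => by simp [hS]
  -- Exchange the tails at the selected pair; the transposition reverses the sign.
  have hbadsum : ∑ x ∈ S with (∃ p q, BadPair N b x.2 p q), ((Equiv.Perm.sign x.1 : ℤˣ) : ℤ) = 0 := by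
    have hsel : ∀ x ∈ S.filter (fun x => ∃ p q, BadPair N b x.2 p q),
        ∃ p q, Selected N b x.2 p q := by
      intro x hx
      rw [Finset.mem_filter, hmem] at hx
      obtain ⟨hx, p, q, h⟩ := hx
      exact h.exists_selected hx.chain
    choose p q hpq using hsel
    have hpq' : ∀ x (hx : x ∈ S.filter (fun x => ∃ p q, BadPair N b x.2 p q)),
        IsArray N a b M x ∧
          (x.1 * Equiv.swap (p x hx).2 (q x hx).2, swapTails b (p x hx) (q x hx) x.2) ∈ S.filter (fun x => ∃ p q, BadPair N b x.2 p q) := by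
      intro x hx
      have h1 := hpq x hx
      have hx' := hx
      rw [Finset.mem_filter, hmem] at hx'
      refine ⟨hx'.1, ?_⟩
      rw [Finset.mem_filter, hmem]
      exact ⟨hx'.1.swapTails h1.bad, _, _, badPair_swapTails_self hx'.1.chain h1.bad⟩
    refine Finset.sum_involution
      (fun x hx => (x.1 * Equiv.swap (p x hx).2 (q x hx).2, swapTails b (p x hx) (q x hx) x.2)) ?_ ?_ ?_ ?_
    · intro x hx
      have hne := (hpq x hx).bad.snd_ne (hpq' x hx).1.chain
      simp [Equiv.Perm.sign_swap hne]
    · intro x hx _ heq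
      have hne := (hpq x hx).bad.snd_ne (hpq' x hx).1.chain
      have h1 := congrArg Prod.fst heq
      simp only [mul_eq_left, Equiv.swap_eq_one_iff] at h1
      exact hne h1
    · intro x hx
      exact (hpq' x hx).2
    · intro x hx
      obtain ⟨hx1, hx2⟩ := hpq' x hx
      have h1 := (hpq x hx).swapTails hx1.chain
      obtain ⟨h2, h3⟩ := (hpq _ hx2).unique h1
      refine Prod.ext ?_ ?_
      · dsimp only
        rw [h2, h3, mul_assoc, Equiv.swap_mul_self, mul_one]
      · dsimp only
        rw [h2, h3]
        exact swapTails_swapTails hx1.chain (hpq x hx).bad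
  rw [← Finset.sum_filter_add_sum_filter_not S (fun x => ∃ p q, BadPair N b x.2 p q), hbadsum,
    zero_add]
  -- Flawlessness puts the ends in cyclic order, so the congruences and the total determine them and
  -- the permutation.
  have hkey : ∀ x : Equiv.Perm (Fin l) × (Fin l → List Q),
      x ∈ S.filter (fun x => ¬ ∃ p q, BadPair N b x.2 p q) ↔ x.1 = 1 ∧
        (∀ j, (x.2 j).IsChain (· < ·)) ∧ (∀ j, b j + (x.2 j).length = a j) ∧
        Flawless N b x.2 ∧ ∑ j, (↑(x.2 j) : Multiset Q) = M := by
    intro x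
    rw [Finset.mem_filter, hmem]
    constructor
    · rintro ⟨hx, hbad⟩
      push Not at hbad
      rcases Nat.eq_zero_or_pos l with rfl | hl
      · exact ⟨Subsingleton.elim _ _, hx.chain, fun j => j.elim0, fun hl => absurd hl (lt_irrefl 0),
          hx.content⟩
      · have hfl := flawless_of_not_badPair hQ (hN hl) hb hx.chain hbad
        obtain ⟨h1, h2⟩ := ha.eq_of_modEq hfl.cyclicAnti x.1 hx.modEq hx.sum_eq (hN hl)
        exact ⟨h1, hx.chain, congrFun h2, hfl, hx.content⟩
    · rintro ⟨h1, h2, h3, h4, h5⟩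
      refine ⟨⟨h2, h5, Finset.sum_congr rfl fun j _ => h3 j, fun j => ?_⟩, ?_⟩
      · rw [h3, h1]
        rfl
      · rintro ⟨p, q, h⟩
        exact h4.not_badPair hQ h2 p q h
  rw [Finset.sum_congr rfl (g := fun _ => (1 : ℤ)) (fun x hx => by
    rw [((hkey x).1 hx).1]; simp)]
  rw [Finset.sum_const, nsmul_eq_mul, mul_one, Nat.cast_inj, ← Nat.subtype_card _ hkey]
  exact Nat.card_congr
    { toFun := fun x => ⟨x.1.2, x.2.2⟩
      invFun := fun C => ⟨(1, C.1), rfl, C.2⟩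
      left_inv := fun x => Subtype.ext (Prod.ext x.2.1.symm rfl)
      right_inv := fun C => rfl }

end SignedCount

/-! ### Cylindric tableaux as arrays of chains -/

section Tableaux

variable {Q : Type*} [PartialOrder Q] {lam mu : YoungDiagram} {d : ℕ}

theorem mem_skew {i j : ℕ} : (i, j) ∈ lam.cells \ mu.cells ↔ mu.colLen j ≤ i ∧ i < lam.colLen j := by
  rw [Finset.mem_sdiff, YoungDiagram.mem_cells, YoungDiagram.mem_cells,
    YoungDiagram.mem_iff_lt_colLen, YoungDiagram.mem_iff_lt_colLen, not_lt, and_comm]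

theorem sub_colLen_lt (b : SkewBox lam mu) :
    b.1.1 - mu.colLen b.1.2 < lam.colLen b.1.2 - mu.colLen b.1.2 := by
  obtain ⟨⟨i, j⟩, hb⟩ := b
  have := mem_skew.1 hb
  dsimp only
  omega

theorem lt_rowLen_of_lt_colLen {i j : ℕ} (h : i < lam.colLen j) : j < lam.rowLen 0 := by
  rw [← YoungDiagram.mem_iff_lt_rowLen, YoungDiagram.mem_iff_lt_colLen]
  omega

theorem colLen_mono (h : mu ≤ lam) (j : ℕ) : mu.colLen j ≤ lam.colLen j := by
  by_contra hlt
  rw [not_le, ← YoungDiagram.mem_iff_lt_colLen] at hlt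
  have := h hlt
  rw [YoungDiagram.mem_iff_lt_colLen] at this
  omega

/-- The starting times of the columns of `kap`, as chains on the cylinder. -/
def colStart (l : ℕ) (kap : YoungDiagram) (j : Fin l) : ℤ := kap.colLen j - j

/-- The term `-j` makes weakly decreasing column lengths strictly decreasing and adds at most `l -
1` to a spread of at most `d`. -/
theorem cyclicAnti_colStart {l : ℕ} {kap : YoungDiagram}
    (h : kap.colLen 0 - kap.colLen (l - 1) ≤ d) : CyclicAnti (l + d : ℕ) (colStart l kap) := by
  constructor
  · intro i j hij
    have := kap.colLen_anti i j (le_of_lt hij)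
    have h2 : (i : ℕ) < j := hij
    simp only [colStart]
    omega
  · intro i j
    have h1 := kap.colLen_anti 0 i (Nat.zero_le _)
    have h2 := kap.colLen_anti j (l - 1) (by omega)
    simp only [colStart]
    omega

/-- The columns of a filling, read from top to bottom. -/
def colList (T : SkewBox lam mu → Q) (j : Fin (lam.rowLen 0)) : List Q :=
  List.ofFn fun i : Fin (lam.colLen j - mu.colLen j) =>
    T ⟨(mu.colLen j + i, j), mem_skew.2 ⟨by omega, by omega⟩⟩

theorem length_colList (T : SkewBox lam mu → Q) (j : Fin (lam.rowLen 0)) :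
    (colList T j).length = lam.colLen j - mu.colLen j := by
  simp [colList]

theorem start_add_length (hsub : mu ≤ lam) (T : SkewBox lam mu → Q) (j : Fin (lam.rowLen 0)) :
    colStart _ mu j + (colList T j).length = colStart _ lam j := by
  have := colLen_mono hsub j
  rw [length_colList]
  simp only [colStart]
  omega

theorem entry_colList (T : SkewBox lam mu → Q) {i j : ℕ} (h : (i, j) ∈ lam.cells \ mu.cells)
    (hj : j < lam.rowLen 0) :
    entry (colStart _ mu) (colList T) ((i : ℤ) - j, ⟨j, hj⟩) =
      ((T ⟨(i, j), h⟩ : WithTop Q) : WithBot (WithTop Q)) := by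
  have h1 := mem_skew.1 h
  obtain ⟨n, rfl⟩ := Nat.exists_eq_add_of_le h1.1
  have h2 := strand_getElem (colStart _ mu ⟨j, hj⟩) (colList T ⟨j, hj⟩) n
    (by rw [length_colList]; dsimp only; omega)
  rw [entry]
  have h3 : colStart _ mu ⟨j, hj⟩ + n = ((mu.colLen j + n : ℕ) : ℤ) - j := by
    simp only [colStart]; push_cast; ring
  rw [h3] at h2
  rw [h2]
  simp [colList]

theorem entry_colList_eq_bot (T : SkewBox lam mu → Q) {i : ℤ} {j : Fin (lam.rowLen 0)} :
    entry (colStart _ mu) (colList T) (i - j, j) = ⊥ ↔ i < mu.colLen j := by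
  rw [entry, strand_eq_bot, colStart]
  constructor <;> intro h <;> linarith

theorem entry_colList_eq_top (hsub : mu ≤ lam) (T : SkewBox lam mu → Q) {i : ℤ}
    {j : Fin (lam.rowLen 0)} :
    entry (colStart _ mu) (colList T) (i - j, j) = ⊤ ↔ lam.colLen j ≤ i := by
  rw [entry, strand_eq_top, start_add_length hsub, colStart]
  constructor <;> intro h <;> linarith

/-- Padding creates no flaws: in a strict inequality the smaller entry is not `⊤` and the larger is
not `⊥`, and the bounds on column lengths then place both in actual boxes. -/
theorem forall_not_entry_lt_iff (hsub : mu ≤ lam) (T : SkewBox lam mu → Q)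
    (j k : Fin (lam.rowLen 0)) (e : ℕ) (hmu : mu.colLen k ≤ mu.colLen j + e)
    (hlam : lam.colLen k ≤ lam.colLen j + e) :
    (∀ i : ℤ, ¬ entry (colStart _ mu) (colList T) (i + e - k, k) <
      entry (colStart _ mu) (colList T) (i - j, j)) ↔
    ∀ (i : ℕ) (h : (i, (j : ℕ)) ∈ lam.cells \ mu.cells)
      (h' : (i + e, (k : ℕ)) ∈ lam.cells \ mu.cells), ¬ T ⟨_, h'⟩ < T ⟨_, h⟩ := by
  constructor
  · intro h i h1 h2 hlt
    refine h i ?_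
    have e1 := entry_colList T h1 j.2
    have e2 := entry_colList T h2 k.2
    rw [Nat.cast_add] at e2
    rw [e1, e2, WithBot.coe_lt_coe, WithTop.coe_lt_coe]
    exact hlt
  · intro h i hlt
    have h1 : ¬ i < mu.colLen j := by
      rw [← entry_colList_eq_bot T]
      exact (bot_le.trans_lt hlt).ne'
    have h2 : ¬ (lam.colLen k : ℤ) ≤ i + e := by
      rw [← entry_colList_eq_top hsub T]
      exact (hlt.trans_le le_top).ne
    obtain ⟨n, rfl⟩ := Int.eq_ofNat_of_zero_le (show 0 ≤ i by omega)
    have m1 : (n, (j : ℕ)) ∈ lam.cells \ mu.cells := mem_skew.2 ⟨by omega, by omega⟩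
    have m2 : (n + e, (k : ℕ)) ∈ lam.cells \ mu.cells := mem_skew.2 ⟨by omega, by omega⟩
    have e1 := entry_colList T m1 j.2
    have e2 := entry_colList T m2 k.2
    rw [Nat.cast_add] at e2
    rw [e1, e2, WithBot.coe_lt_coe, WithTop.coe_lt_coe] at hlt
    exact h n m1 m2 hlt

/-- Within one turn of the cover, neighbors lie in the same row. From the last column to the first,
the period `l + d` amounts to a shift by `d` rows. -/
theorem flawless_colList_iff (hshape : IsCylindricShape lam mu d) (T : SkewBox lam mu → Q) :
    Flawless (lam.rowLen 0 + d : ℕ) (colStart _ mu) (colList T) ↔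
      (∀ (i j : ℕ) (h : (i, j) ∈ lam.cells \ mu.cells)
        (h' : (i, j + 1) ∈ lam.cells \ mu.cells), ¬ T ⟨_, h'⟩ < T ⟨_, h⟩) ∧
      (∀ (i : ℕ) (h : (i, lam.rowLen 0 - 1) ∈ lam.cells \ mu.cells)
        (h' : (i + d, 0) ∈ lam.cells \ mu.cells), ¬ T ⟨_, h'⟩ < T ⟨_, h⟩) := by
  have hadj := fun (j k : Fin (lam.rowLen 0)) (hjk : (k : ℕ) = j + 1) =>
    forall_not_entry_lt_iff hshape.sub T j k 0
      (mu.colLen_anti j k (by omega)) (lam.colLen_anti j k (by omega))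
  have hwrap := fun (j k : Fin (lam.rowLen 0)) (hj : (j : ℕ) = lam.rowLen 0 - 1)
      (hk : (k : ℕ) = 0) => forall_not_entry_lt_iff hshape.sub T j k d
    (by rw [hj, hk]; have := hshape.lower_inner; omega)
    (by rw [hj, hk]; have := hshape.lower_outer; omega)
  constructor
  · intro h
    constructor
    · intro i j h1 h2
      have hj := lt_rowLen_of_lt_colLen (mem_skew.1 h1).2
      have hj' := lt_rowLen_of_lt_colLen (mem_skew.1 h2).2
      refine (hadj ⟨j, hj⟩ ⟨j + 1, hj'⟩ rfl).1 (fun x => ?_) i h1 h2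
      have h3 := h (by omega) j (x - j - 1)
      have h4 : wrap (by omega) j = (⟨j, hj⟩ : Fin (lam.rowLen 0)) :=
        Fin.ext (Nat.mod_eq_of_lt hj)
      have h5 : wrap (by omega) (j + 1) = (⟨j + 1, hj'⟩ : Fin (lam.rowLen 0)) :=
        Fin.ext (Nat.mod_eq_of_lt hj')
      simp only [cover, h4, h5, Nat.div_eq_of_lt hj, Nat.div_eq_of_lt hj'] at h3
      convert h3 using 3 <;> push_cast <;> ring_nf
    · intro i h1 h2
      have hj := lt_rowLen_of_lt_colLen (mem_skew.1 h1).2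
      have hj' := lt_rowLen_of_lt_colLen (mem_skew.1 h2).2
      refine (hwrap ⟨_, hj⟩ ⟨0, hj'⟩ rfl rfl).1 (fun x => ?_) i h1 h2
      have h3 := h hj' (lam.rowLen 0 - 1) (x - lam.rowLen 0)
      have h4 : wrap hj' (lam.rowLen 0 - 1) = (⟨_, hj⟩ : Fin (lam.rowLen 0)) :=
        Fin.ext (Nat.mod_eq_of_lt hj)
      have h5 : wrap hj' (lam.rowLen 0 - 1 + 1) = (⟨0, hj'⟩ : Fin (lam.rowLen 0)) :=
        Fin.ext (by rw [Nat.sub_add_cancel hj']; exact Nat.mod_self _)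
      simp only [cover, h4, h5, Nat.div_eq_of_lt hj] at h3
      rw [Nat.sub_add_cancel hj', Nat.div_self hj'] at h3
      convert h3 using 3
      · push_cast; ring_nf
      · push_cast [Nat.cast_sub hj']; ring_nf
  · rintro ⟨h1, h2⟩ hl n x
    rcases wrap_succ hl n with ⟨h3, h4, h5⟩ | ⟨h3, h4, h5⟩
    · have h6 := (hadj _ _ h4).2 (fun i h h' => by
        have h7 : (i, ((wrap hl n : Fin _) : ℕ) + 1) ∈ lam.cells \ mu.cells := by
          rw [← h4]; exact h'
        have := h1 i _ h h7
        simpa only [h4, add_zero] using this) (x + 1 + (n / lam.rowLen 0 : ℕ) * (lam.rowLen 0 + d : ℕ) +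
          (wrap hl n : Fin _))
      simp only [cover, h5]
      convert h6 using 3
      · rw [h4]; push_cast; ring_nf
      · ring_nf
    · have h6 := (hwrap _ _ h3 h4).2 (fun i h h' => by
        have h7 : (i, lam.rowLen 0 - 1) ∈ lam.cells \ mu.cells := by rw [← h3]; exact h
        have h8 : (i + d, 0) ∈ lam.cells \ mu.cells := by
          rw [h4] at h'; exact h'
        have := h2 i h7 h8
        simpa only [h3, h4] using this) (x + 1 + (n / lam.rowLen 0 : ℕ) * (lam.rowLen 0 + d : ℕ) +
          (wrap hl n : Fin _))
      simp only [cover, h5]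
      convert h6 using 3
      · rw [h4, h3]; push_cast [Nat.cast_sub hl]; ring_nf
      · ring_nf

theorem isChain_colList_iff (T : SkewBox lam mu → Q) :
    (∀ j, (colList T j).IsChain (· < ·)) ↔
      ∀ (i j : ℕ) (h : (i, j) ∈ lam.cells \ mu.cells) (h' : (i + 1, j) ∈ lam.cells \ mu.cells),
        T ⟨_, h⟩ < T ⟨_, h'⟩ := by
  simp only [List.isChain_iff_getElem, colList, List.getElem_ofFn, List.length_ofFn]
  constructor
  · intro h i j h1 h2
    have h3 := mem_skew.1 h1
    have h4 := mem_skew.1 h2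
    obtain ⟨n, rfl⟩ := Nat.exists_eq_add_of_le h3.1
    exact h ⟨j, lt_rowLen_of_lt_colLen h3.2⟩ n (by dsimp only; omega)
  · intro h j n hn
    exact h (mu.colLen j + n) j _ _

theorem mem_gluedShape {i j : ℕ} (hj : j < lam.rowLen 0) :
    (i + d, j) ∈ gluedShape lam mu d ↔ (i, j) ∈ lam.cells \ mu.cells := by
  rw [mem_skew]
  change gluedCol (lam.rowLen 0) d mu j ≤ i + d ∧ i + d < gluedCol (lam.rowLen 0) d lam j ↔ _
  simp only [gluedCol, if_pos hj]
  omega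

theorem mem_gluedShape_last {i : ℕ} :
    (i, lam.rowLen 0) ∈ gluedShape lam mu d ↔ (i, 0) ∈ lam.cells \ mu.cells := by
  rw [mem_skew]
  change gluedCol (lam.rowLen 0) d mu _ ≤ i ∧ i < gluedCol (lam.rowLen 0) d lam _ ↔ _
  simp [gluedCol]

theorem le_of_mem_gluedShape {i j : ℕ} (h : (i, j) ∈ gluedShape lam mu d) :
    (j < lam.rowLen 0 ∧ d ≤ i) ∨ j = lam.rowLen 0 := by
  have h1 : gluedCol (lam.rowLen 0) d mu j ≤ i ∧ i < gluedCol (lam.rowLen 0) d lam j := h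
  simp only [gluedCol] at h1
  split_ifs at h1 with h2 h3
  · left; omega
  · exact Or.inr h3
  · omega

theorem glue_apply (T : SkewBox lam mu → Q) {i j : ℕ} (hj : j < lam.rowLen 0)
    (h : (i + d, j) ∈ gluedShape lam mu d) :
    glue d T ⟨_, h⟩ = T ⟨(i, j), (mem_gluedShape hj).1 h⟩ := by
  rw [glue]
  congr 1
  refine Subtype.ext ?_
  simp [unglue, hj]

theorem glue_apply_last (T : SkewBox lam mu → Q) {i : ℕ}
    (h : (i, lam.rowLen 0) ∈ gluedShape lam mu d) :
    glue d T ⟨_, h⟩ = T ⟨(i, 0), mem_gluedShape_last.1 h⟩ := by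
  rw [glue]
  congr 1
  refine Subtype.ext ?_
  simp [unglue]

/-- The glued column repeats the first one, so gluing adds only the comparisons of the last column
with the first. -/
theorem isCylindricPTableau_iff (T : SkewBox lam mu → Q) :
    IsCylindricPTableau d T ↔
      (∀ (i j : ℕ) (h : (i, j) ∈ lam.cells \ mu.cells) (h' : (i + 1, j) ∈ lam.cells \ mu.cells),
        T ⟨_, h⟩ < T ⟨_, h'⟩) ∧
      (∀ (i j : ℕ) (h : (i, j) ∈ lam.cells \ mu.cells)
        (h' : (i, j + 1) ∈ lam.cells \ mu.cells), ¬ T ⟨_, h'⟩ < T ⟨_, h⟩) ∧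
      (∀ (i : ℕ) (h : (i, lam.rowLen 0 - 1) ∈ lam.cells \ mu.cells)
        (h' : (i + d, 0) ∈ lam.cells \ mu.cells), ¬ T ⟨_, h'⟩ < T ⟨_, h⟩) := by
  constructor
  · rintro ⟨hcol, hrow⟩
    refine ⟨fun i j h h' => ?_, fun i j h h' => ?_, fun i h h' => ?_⟩
    · have hj := lt_rowLen_of_lt_colLen (mem_skew.1 h).2
      have h1 := hcol (i + d) j ((mem_gluedShape hj).2 h)
        (by rw [Nat.add_right_comm]; exact (mem_gluedShape hj).2 h')
      rw [glue_apply T hj] at h1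
      simp only [Nat.add_right_comm i d 1] at h1
      rwa [glue_apply T hj] at h1
    · have hj := lt_rowLen_of_lt_colLen (mem_skew.1 h).2
      have hj' := lt_rowLen_of_lt_colLen (mem_skew.1 h').2
      have h1 := hrow (i + d) j ((mem_gluedShape hj).2 h) ((mem_gluedShape hj').2 h')
      rwa [glue_apply T hj, glue_apply T hj'] at h1
    · have hj := lt_rowLen_of_lt_colLen (mem_skew.1 h).2
      have e : lam.rowLen 0 - 1 + 1 = lam.rowLen 0 := by omega
      have h1 := hrow (i + d) (lam.rowLen 0 - 1) ((mem_gluedShape hj).2 h)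
        (by rw [e]; exact mem_gluedShape_last.2 h')
      rw [glue_apply T hj] at h1
      simp only [e] at h1
      rwa [glue_apply_last] at h1
  · rintro ⟨hcol, hrow, hlast⟩
    constructor
    · intro i j h h'
      rcases le_of_mem_gluedShape h with ⟨hj, hd⟩ | rfl
      · obtain ⟨i, rfl⟩ := Nat.exists_eq_add_of_le' hd
        rw [glue_apply T hj]
        simp only [Nat.add_right_comm i d 1] at h' ⊢
        rw [glue_apply T hj]
        exact hcol _ _ _ _
      · rw [glue_apply_last, glue_apply_last]
        exact hcol _ _ _ _
    · intro i j h h'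
      rcases le_of_mem_gluedShape h with ⟨hj, hd⟩ | rfl
      · obtain ⟨i, rfl⟩ := Nat.exists_eq_add_of_le' hd
        rw [glue_apply T hj]
        rcases le_of_mem_gluedShape h' with ⟨hj', -⟩ | hj'
        · rw [glue_apply T hj']
          exact hrow _ _ _ _
        · obtain rfl : j = lam.rowLen 0 - 1 := by omega
          simp only [hj'] at h' ⊢
          rw [glue_apply_last]
          exact hlast _ _ _
      · rcases le_of_mem_gluedShape h' with ⟨hj', -⟩ | hj'
        · omega
        · omega

theorem colList_injective : Function.Injective (colList (Q := Q) (lam := lam) (mu := mu)) := by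
  intro T T' h
  funext ⟨⟨i, j⟩, hb⟩
  have hj := lt_rowLen_of_lt_colLen (mem_skew.1 hb).2
  have h1 := entry_colList T hb hj
  rw [h, entry_colList T' hb hj, WithBot.coe_inj, WithTop.coe_inj] at h1
  exact h1.symm

theorem exists_colList_eq (hsub : mu ≤ lam) (C : Fin (lam.rowLen 0) → List Q)
    (hC : ∀ j, colStart _ mu j + (C j).length = colStart _ lam j) :
    ∃ T : SkewBox lam mu → Q, colList T = C := by
  have hlen : ∀ j : Fin (lam.rowLen 0), (C j).length = lam.colLen j - mu.colLen j := by
    intro j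
    have h1 := hC j
    have := colLen_mono hsub j
    simp only [colStart] at h1
    omega
  refine ⟨fun b => (C ⟨b.1.2, lt_rowLen_of_lt_colLen (mem_skew.1 b.2).2⟩)[b.1.1 - mu.colLen b.1.2]'
    (by rw [hlen]; exact sub_colLen_lt b), ?_⟩
  funext j
  refine List.ext_getElem (by rw [length_colList, hlen]) fun n h1 h2 => ?_
  simp [colList]

theorem sum_colList (T : SkewBox lam mu → Q) :
    ∑ j, (↑(colList T j) : Multiset Q) = Finset.univ.val.map T := by
  have hsing : ∀ {α : Type} [Fintype α] (f : α → Q),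
      Finset.univ.val.map f = ∑ i, ({f i} : Multiset Q) := by
    intro α _ f
    rw [Finset.sum_eq_multiset_sum, ← Multiset.sum_map_singleton (Finset.univ.val.map f),
      Multiset.map_map]
    rfl
  have h1 : ∀ j : Fin (lam.rowLen 0), (↑(colList T j) : Multiset Q) =
      ∑ i : Fin (lam.colLen j - mu.colLen j),
        {T ⟨(mu.colLen j + i, j), mem_skew.2 ⟨by omega, by omega⟩⟩} := by
    intro j
    rw [← hsing, Fin.univ_val_map]
    rfl
  rw [hsing, Finset.sum_congr rfl fun j _ => h1 j, ← Fintype.sum_sigma']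
  refine Fintype.sum_bijective
    (fun x : Σ j : Fin (lam.rowLen 0), Fin (lam.colLen j - mu.colLen j) =>
      (⟨(mu.colLen x.1 + x.2, x.1), mem_skew.2 ⟨by omega, by omega⟩⟩ : SkewBox lam mu))
    ⟨?_, ?_⟩ _ _ fun _ => rfl
  · rintro ⟨j, i⟩ ⟨j', i'⟩ h
    rw [Subtype.mk.injEq, Prod.mk.injEq] at h
    obtain rfl : j = j' := Fin.ext h.2
    obtain rfl : i = i' := Fin.ext (by simpa using h.1)
    rfl
  · rintro ⟨⟨i, j⟩, hb⟩
    have h2 := mem_skew.1 hb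
    have hj := lt_rowLen_of_lt_colLen h2.2
    obtain ⟨n, rfl⟩ := Nat.exists_eq_add_of_le h2.1
    exact ⟨⟨⟨j, hj⟩, ⟨n, by dsimp only; omega⟩⟩, rfl⟩

/-- Cylindric tableaux correspond to flawless arrays of chains. -/
theorem card_cylindricPTableau (hshape : IsCylindricShape lam mu d) (M : Multiset Q) :
    Nat.card {T : SkewBox lam mu → Q //
      IsCylindricPTableau d T ∧ Finset.univ.val.map T = M} =
    Nat.card {C : Fin (lam.rowLen 0) → List Q // (∀ j, (C j).IsChain (· < ·)) ∧
      (∀ j, colStart _ mu j + (C j).length = colStart _ lam j) ∧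
      Flawless (lam.rowLen 0 + d : ℕ) (colStart _ mu) C ∧ ∑ j, (↑(C j) : Multiset Q) = M} := by
  have hiff : ∀ T : SkewBox lam mu → Q, IsCylindricPTableau d T ↔
      (∀ j, (colList T j).IsChain (· < ·)) ∧
        Flawless (lam.rowLen 0 + d : ℕ) (colStart _ mu) (colList T) := by
    intro T
    rw [isCylindricPTableau_iff, isChain_colList_iff, flawless_colList_iff hshape]
  refine Nat.card_eq_of_bijective (fun T => ⟨colList T.1, ((hiff _).1 T.2.1).1,
    start_add_length hshape.sub T.1, ((hiff _).1 T.2.1).2, by rw [sum_colList]; exact T.2.2⟩)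
    ⟨fun T T' h => Subtype.ext (colList_injective (congrArg Subtype.val h)), ?_⟩
  rintro ⟨C, h1, h2, h3, h4⟩
  obtain ⟨T, rfl⟩ := exists_colList_eq hshape.sub C h2
  exact ⟨⟨T, (hiff T).2 ⟨h1, h3⟩, by rw [← sum_colList]; exact h4⟩, rfl⟩

end Tableaux

/-! ### Expansion into products of elementary functions -/

section Expansion

variable {Q : Type*} [PartialOrder Q] {l : ℕ}

open Classical in
/-- The signed number of ways in which chains with lengths `n` that start at `b` end at the times
`a`, up to a permutation and to multiples of `N`. -/
noncomputable def lengthSign (N : ℤ) (a b : Fin l → ℤ) (n : Fin l → ℕ) : ℤ :=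
  ∑ σ : Equiv.Perm (Fin l) with ∀ j, b j + n j ≡ a (σ j) [ZMOD N], ((Equiv.Perm.sign σ : ℤˣ) : ℤ)

-- Group the arrays by chain lengths: once these are fixed, the permutation and the chains vary
-- independently.
open Classical in
theorem coeff_sum_lengthSign (N : ℤ) (a b : Fin l → ℤ) (D : ℕ) (hD : ∑ j, a j = ∑ j, b j + D)
    (m : Q →₀ ℕ) :
    MvPowerSeries.coeff m (∑ n ∈ Finset.piAntidiag Finset.univ D,
      lengthSign N a b n • ∏ j, chainSeries Q (n j)) =
    ∑ x ∈ (finite_isArray (N := N) (a := a) (b := b) (M := Finsupp.toMultiset m)).toFinset,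
      ((Equiv.Perm.sign x.1 : ℤˣ) : ℤ) := by
  rw [map_sum, ← Finset.sum_fiberwise_of_maps_to
    (g := fun (x : Equiv.Perm (Fin l) × (Fin l → List Q)) j => (x.2 j).length)
    (s := (finite_isArray (N := N) (a := a) (b := b) (M := Finsupp.toMultiset m)).toFinset)
    (t := Finset.piAntidiag Finset.univ D)]
  · refine Finset.sum_congr rfl fun n hn => ?_
    rw [Finset.mem_piAntidiag] at hn
    rw [map_zsmul, coeff_prod_chainSeries_list, lengthSign]
    set A : Set (Fin l → List Q) := {C | (∀ i, (C i).IsChain (· < ·)) ∧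
      (∀ i, (C i).length = n i) ∧ ∑ i, (↑(C i) : Multiset Q) = Finsupp.toMultiset m} with hA
    have hAfin : A.Finite := (finite_lists (Finsupp.toMultiset m)).subset fun C hC => hC.2.2
    have hcard : Nat.card {C : Fin l → List Q // (∀ i, (C i).IsChain (· < ·)) ∧
        (∀ i, (C i).length = n i) ∧ ∑ i, (↑(C i) : Multiset Q) = Finsupp.toMultiset m} =
        hAfin.toFinset.card := Nat.subtype_card _ fun C => by simp [hA]
    rw [hcard]
    have hprod : Finset.filter (fun x => (fun j => (x.2 j).length) = n)
        (finite_isArray (N := N) (a := a) (b := b) (M := Finsupp.toMultiset m)).toFinset =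
        (Finset.univ.filter fun σ : Equiv.Perm (Fin l) =>
          ∀ j, b j + n j ≡ a (σ j) [ZMOD N]) ×ˢ hAfin.toFinset := by
      ext ⟨σ, C⟩
      simp only [Finset.mem_filter, Set.Finite.mem_toFinset, Set.mem_ofPred_eq, Finset.mem_product,
        Finset.mem_univ, true_and, hA]
      constructor
      · rintro ⟨h, rfl⟩
        exact ⟨h.modEq, h.chain, fun _ => rfl, h.content⟩
      · rintro ⟨h1, h2, h3, h4⟩
        obtain rfl : (fun j => (C j).length) = n := funext h3
        refine ⟨⟨h2, h4, ?_, h1⟩, rfl⟩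
        rw [Finset.sum_add_distrib, hD, add_right_inj]
        exact_mod_cast hn.1
    rw [hprod, Finset.sum_product, Finset.sum_smul]
    simp only [Finset.sum_const, smul_eq_mul, nsmul_eq_mul, mul_comm]
  · intro x hx
    rw [Set.Finite.mem_toFinset] at hx
    rw [Finset.mem_piAntidiag]
    refine ⟨?_, by simp⟩
    have h := hx.sum_eq
    rw [Finset.sum_add_distrib, hD, add_right_inj] at h
    exact_mod_cast h

variable {lam mu : YoungDiagram} {d : ℕ}

/-- The coefficients of the expansion of the cylindric Schur function into products of elementary
symmetric functions. -/
noncomputable def cylCoeff (lam mu : YoungDiagram) (d : ℕ) (n : Fin (lam.rowLen 0) → ℕ) : ℤ :=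
  lengthSign (lam.rowLen 0 + d : ℕ) (colStart _ lam) (colStart _ mu) n

open Classical in
/-- The lengths of the chains in the expansion of the cylindric Schur function. -/
noncomputable def cylLengths (lam mu : YoungDiagram) : Finset (Fin (lam.rowLen 0) → ℕ) :=
  Finset.piAntidiag Finset.univ (∑ j : Fin (lam.rowLen 0), (lam.colLen j - mu.colLen j))

/-- The combination of products of chain series that enumerates cylindric tableaux. -/
theorem coeff_sum_lengthSign_eq_card (hQ : ThreePlusOneFree Q) (hshape : IsCylindricShape lam mu d)
    (m : Q →₀ ℕ) :
    MvPowerSeries.coeff m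
      (∑ n ∈ cylLengths lam mu, cylCoeff lam mu d n • ∏ j, chainSeries Q (n j)) =
    Nat.card {T : SkewBox lam mu → Q //
      IsCylindricPTableau d T ∧ ∑ b, Finsupp.single (T b) 1 = m} := by
  rw [cylLengths]
  simp only [cylCoeff]
  rw [coeff_sum_lengthSign, sum_sign_isArray hQ (by intro h; push_cast; omega)
    (cyclicAnti_colStart hshape.lower_outer) (cyclicAnti_colStart hshape.lower_inner),
    ← card_cylindricPTableau hshape, Nat.cast_inj]
  · refine Nat.card_congr (Equiv.subtypeEquivRight fun T => ?_)
    have h : Finset.univ.val.map T = Finsupp.toMultiset (∑ b, Finsupp.single (T b) 1) := by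
      rw [map_sum, ← Multiset.sum_map_singleton (Multiset.map T _), Multiset.map_map,
        Finset.sum_eq_multiset_sum]
      simp
    rw [h, toMultiset_injective.eq_iff]
  · rw [Nat.cast_sum, ← Finset.sum_add_distrib]
    refine Finset.sum_congr rfl fun j _ => ?_
    have := colLen_mono hshape.sub j
    simp only [colStart]
    omega

end Expansion

/-! ### Symmetry of the monomial coefficients of `e_ν` -/

section Matrices

theorem prod_map_expType {α M : Type*} [CommMonoid M] (m : α →₀ ℕ) (f : ℕ → M) :
    ((expType m).map f).prod = ∏ i : m.support, f (m i) := by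
  rw [expType, Multiset.map_map]
  exact (Finset.prod_coe_sort m.support fun i => f (m i)).symm

theorem count_sum_map_val_filter {ι β : Type*} [Fintype ι] [DecidableEq β] {s : Finset β}
    (A : ι → s → Bool) (j : s) :
    (∑ i, (Finset.univ.filter (fun j => A i j)).val.map Subtype.val).count (j : β) =
      (Finset.univ.filter fun i => A i j).card := by
  rw [Multiset.count_sum', Finset.card_filter]
  refine Finset.sum_congr rfl fun i _ => ?_
  rw [Multiset.count_map_eq_count' _ _ Subtype.val_injective]
  split_ifs with h
  · exact Multiset.count_eq_one_of_mem (Finset.nodup _)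
      (Finset.mem_filter.2 ⟨Finset.mem_univ _, h⟩)
  · exact Multiset.count_eq_zero_of_notMem fun h1 => h (Finset.mem_filter.1 h1).2

/-- Row `i` of the matrix marks the variables taken from the factor `e_{p i}`. -/
theorem coeff_prod_esymm_eq_card_matrix (p q : ℕ →₀ ℕ) :
    MvPowerSeries.coeff q ((expType p).map esymm).prod =
      Nat.card {A : p.support → q.support → Bool //
        (∀ i : p.support, (Finset.univ.filter fun j => A i j).card = p i) ∧
        ∀ j : q.support, (Finset.univ.filter fun i => A i j).card = q j} := by
  classical
  rw [prod_map_expType]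
  simp only [esymm_eq_chainSeries]
  rw [coeff_prod_chainSeries, Nat.cast_inj]
  symm
  have hmem : ∀ (A : p.support → q.support → Bool) (i : p.support) (j : q.support),
      (j : ℕ) ∈ (Finset.univ.filter (fun j => A i j)).val.map Subtype.val ↔ A i j := by
    intro A i j
    rw [Multiset.mem_map_of_injective Subtype.val_injective, Finset.mem_val, Finset.mem_filter]
    exact and_iff_right (Finset.mem_univ _)
  refine Nat.card_eq_of_bijective
    (fun A => ⟨fun i => (Finset.univ.filter (fun j => A.1 i j)).val.map Subtype.val,
      fun i => ⟨(Finset.nodup _).map Subtype.val_injective, isChain_of_trichotomous _⟩,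
      fun i => by rw [Multiset.card_map]; exact A.2.1 i, ?_⟩) ⟨fun A A' h => ?_, fun S => ?_⟩
  · ext j
    rw [Finsupp.count_toMultiset]
    by_cases hj : j ∈ q.support
    · exact (count_sum_map_val_filter A.1 ⟨j, hj⟩).trans (A.2.2 ⟨j, hj⟩)
    · rw [Finsupp.notMem_support_iff.1 hj]
      refine Multiset.count_eq_zero_of_notMem fun h => ?_
      obtain ⟨i, -, hi⟩ := Multiset.mem_sum.1 h
      obtain ⟨j', -, rfl⟩ := Multiset.mem_map.1 hi
      exact hj j'.2
  · refine Subtype.ext (funext fun i => funext fun j => ?_)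
    have h1 := congrFun (congrArg Subtype.val h) i
    dsimp only at h1
    rw [Bool.eq_iff_iff, ← hmem, ← hmem, h1]
  · have hS : ∀ i j, j ∈ S.1 i → j ∈ q.support := by
      intro i j hj
      have h1 : j ∈ ∑ i, S.1 i := Multiset.mem_sum.2 ⟨i, Finset.mem_univ _, hj⟩
      rw [S.2.2.2] at h1
      exact (Finsupp.mem_toMultiset q j).1 h1
    set A : p.support → q.support → Bool := fun i j => decide ((j : ℕ) ∈ S.1 i) with hA
    have hAS : ∀ i, (Finset.univ.filter (fun j => A i j)).val.map Subtype.val = S.1 i := by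
      intro i
      refine (Multiset.Nodup.ext ((Finset.nodup _).map Subtype.val_injective) (S.2.1 i).1).2
        fun j => ⟨fun hj => ?_, fun hj => ?_⟩
      · obtain ⟨j', h1, rfl⟩ := Multiset.mem_map.1 hj
        exact of_decide_eq_true (Finset.mem_filter.1 h1).2
      · exact (hmem A i ⟨j, hS i j hj⟩).2 (by simpa [hA] using hj)
    refine ⟨⟨A, fun i => ?_, fun j => ?_⟩, Subtype.ext (funext hAS)⟩
    · rw [← S.2.2.1 i, ← hAS i, Multiset.card_map]
      rfl
    · rw [← count_sum_map_val_filter A j, Finset.sum_congr rfl fun i _ => hAS i, S.2.2.2,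
        Finsupp.count_toMultiset]

theorem coeff_prod_esymm_comm (p q : ℕ →₀ ℕ) :
    MvPowerSeries.coeff q ((expType p).map esymm).prod =
      MvPowerSeries.coeff p ((expType q).map esymm).prod := by
  rw [coeff_prod_esymm_eq_card_matrix, coeff_prod_esymm_eq_card_matrix, Nat.cast_inj]
  exact Nat.card_congr
    { toFun := fun A => ⟨fun j i => A.1 i j, A.2.2, A.2.1⟩
      invFun := fun A => ⟨fun i j => A.1 j i, A.2.2, A.2.1⟩
      left_inv := fun _ => rfl
      right_inv := fun _ => rfl }

theorem coeff_expOf_esymmPart_comm (ν ν' : Ptn) :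
    MvPowerSeries.coeff (expOf ν) (esymmPart ν') = MvPowerSeries.coeff (expOf ν') (esymmPart ν) := by
  have h := coeff_prod_esymm_comm (expOf ν') (expOf ν)
  rwa [expType_expOf, expType_expOf] at h

end Matrices

/-! ### Standard fillings and the monomial `u_P` -/

section Content

theorem sum_single_apply {α β : Type*} [Fintype α] [DecidableEq β] (T : α → β) (p : β) :
    (∑ b, Finsupp.single (T b) 1 : β →₀ ℕ) p = (Finset.univ.filter fun b => T b = p).card := by
  classical
  rw [Finsupp.finsetSum_apply, Finset.card_filter]
  exact Finset.sum_congr rfl fun b _ => by rw [Finsupp.single_apply]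

theorem uP_apply {P : Type*} [Fintype P] (p : P) : uP P p = 1 := by
  classical
  refine (sum_single_apply (fun q : P => q) p).trans (Finset.card_eq_one.2 ⟨p, ?_⟩)
  ext q
  simp

theorem toMultiset_uP (P : Type*) [Fintype P] : Finsupp.toMultiset (uP P) = Finset.univ.val := by
  classical
  ext p
  rw [Finsupp.count_toMultiset, uP_apply,
    Multiset.count_eq_one_of_mem (Finset.nodup _) (Finset.mem_univ p)]

theorem sum_single_eq_uP_iff {P : Type*} [Fintype P] {lam mu : YoungDiagram}
    (T : SkewBox lam mu → P) : ∑ b, Finsupp.single (T b) 1 = uP P ↔ IsStandard T := by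
  classical
  rw [Finsupp.ext_iff, IsStandard]
  refine forall_congr' fun p => ?_
  rw [sum_single_apply, uP_apply, Finset.card_eq_one, Finset.singleton_iff_unique_mem]
  simp

end Content

/-! ### The chromatic symmetric function of the incomparability graph -/

section Chromatic

variable {P : Type*} [PartialOrder P] [Fintype P]

/-- Color classes are chains, so a coloring is an ordered partition of `P` into chains of prescribed
sizes. -/
theorem coeff_chromaticSymFun_incGraph (m : ℕ →₀ ℕ) :
    MvPowerSeries.coeff m (chromaticSymFun (incGraph P)) =
      MvPowerSeries.coeff (uP P) ((expType m).map (chainSeries P)).prod := by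
  classical
  rw [prod_map_expType, coeff_prod_chainSeries, MvPowerSeries.coeff_apply, chromaticSymFun,
    Nat.cast_inj, toMultiset_uP]
  have hcount : ∀ (κ : P → ℕ) (i : ℕ) (v : P),
      (Finset.univ.filter (fun v => κ v = i)).val.count v = if κ v = i then 1 else 0 := by
    intro κ i v
    split_ifs with h
    · exact Multiset.count_eq_one_of_mem (Finset.nodup _) (by simpa using h)
    · exact Multiset.count_eq_zero_of_notMem (by simpa using h)
  have hsupp : ∀ κ : P → ℕ, ∑ v, Finsupp.single (κ v) 1 = m → ∀ v, κ v ∈ m.support := by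
    rintro κ rfl v
    rw [Finsupp.mem_support_iff, sum_single_apply]
    exact (Finset.card_pos.2 ⟨v, by simp⟩).ne'
  refine Nat.card_eq_of_bijective
    (fun κ => ⟨fun i => (Finset.univ.filter fun v => κ.1 v = i).val,
      fun i => ⟨Finset.nodup _, fun a ha b hb _ => ?_⟩, fun i => ?_, ?_⟩)
    ⟨fun κ κ' h => ?_, fun S => ?_⟩
  · have ha' : κ.1 a = i := by simpa using ha
    have hb' : κ.1 b = i := by simpa using hb
    by_contra h
    rw [not_or] at h
    exact κ.1.valid (v := a) (w := b) h (ha'.trans hb'.symm)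
  · have h := sum_single_apply κ.1 i
    rw [κ.2] at h
    exact h.symm
  · ext v
    have hv : κ.1 v ∈ m.support := hsupp κ.1 κ.2 v
    rw [Multiset.count_sum', Multiset.count_eq_one_of_mem (Finset.nodup _) (Finset.mem_univ v),
      Finset.sum_congr rfl fun (i : m.support) _ => hcount κ.1 i v,
      Finset.sum_eq_single_of_mem ⟨κ.1 v, hv⟩ (Finset.mem_univ _), if_pos rfl]
    intro i _ hi
    exact if_neg fun h => hi (Subtype.ext h.symm)
  · refine Subtype.ext (DFunLike.ext _ _ fun v => ?_)
    have hv : κ.1 v ∈ m.support := hsupp κ.1 κ.2 v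
    have h1 : (Finset.univ.filter fun w => κ.1 w = κ.1 v).val =
        (Finset.univ.filter fun w => κ'.1 w = κ.1 v).val :=
      congrFun (congrArg Subtype.val h) ⟨κ.1 v, hv⟩
    have h2 : v ∈ (Finset.univ.filter fun w => κ'.1 w = κ.1 v) := by
      rw [← Finset.mem_val, ← h1]
      simp
    exact (Finset.mem_filter.1 h2).2.symm
  · obtain ⟨S, hchain, hcard, hsum⟩ := S
    have h1 : ∀ v, ∑ i, (S i).count v = 1 := by
      intro v
      rw [← Multiset.count_sum', hsum,
        Multiset.count_eq_one_of_mem (Finset.nodup _) (Finset.mem_univ v)]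
    have h2 : ∀ v, ∃ i, ∀ j, v ∈ S j ↔ i = j := by
      intro v
      obtain ⟨i, -, hi⟩ := Finset.exists_ne_zero_of_sum_ne_zero ((h1 v).trans_ne one_ne_zero)
      refine ⟨i, fun j => ⟨fun hj => ?_, ?_⟩⟩
      · by_contra hij
        have h3 := Finset.add_le_sum (f := fun i => (S i).count v) (fun _ _ => Nat.zero_le _)
          (Finset.mem_univ i) (Finset.mem_univ j) hij
        have h4 := Multiset.count_pos.2 hj
        have h5 := h1 v
        omega
      · rintro rfl
        exact Multiset.count_ne_zero.1 hi
    choose κ hκ using h2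
    have hS : ∀ i : m.support, (Finset.univ.filter fun v => (κ v : ℕ) = i).val = S i := by
      intro i
      refine (Multiset.Nodup.ext (Finset.nodup _) (hchain i).1).2 fun v => ?_
      rw [hκ, Finset.mem_val, Finset.mem_filter, and_iff_right (Finset.mem_univ v),
        Subtype.ext_iff]
    refine ⟨⟨SimpleGraph.Coloring.mk (fun v => (κ v : ℕ)) fun {v w} hvw h => ?_, ?_⟩,
      Subtype.ext (funext hS)⟩
    · have h3 : v ∈ S (κ v) := (hκ v _).2 rfl
      have h4 : w ∈ S (κ v) := (hκ w _).2 (Subtype.ext h.symm)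
      rcases (hchain (κ v)).2 h3 h4 (fun e => hvw.1 e.le) with h5 | h5
      · exact hvw.1 h5
      · exact hvw.2 h5
    · ext i
      change (∑ v, Finsupp.single (κ v : ℕ) 1 : ℕ →₀ ℕ) i = m i
      rw [sum_single_apply]
      by_cases hi : i ∈ m.support
      · rw [← hcard ⟨i, hi⟩, ← hS ⟨i, hi⟩]
        rfl
      · rw [Finsupp.notMem_support_iff.1 hi, Finset.card_eq_zero, Finset.filter_eq_empty_iff]
        rintro v - rfl
        exact hi (κ v).2

theorem chromaticSymFun_mem {V : Type*} [Fintype V] {G : SimpleGraph V}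
    (h : ∀ m m', expType m = expType m' →
      MvPowerSeries.coeff m (chromaticSymFun G) = MvPowerSeries.coeff m' (chromaticSymFun G)) :
    chromaticSymFun G ∈ symFun := by
  refine mem_symFun_iff.2 ⟨h, Fintype.card V, fun m hm => ?_⟩
  rw [MvPowerSeries.coeff_apply, chromaticSymFun, Nat.cast_eq_zero]
  refine @Nat.card_of_isEmpty _ ⟨fun κ => hm.ne ?_⟩
  rw [← κ.2, map_sum]
  simp

theorem chromaticSymFun_incGraph_mem : chromaticSymFun (incGraph P) ∈ symFun := by
  refine chromaticSymFun_mem fun m m' h => ?_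
  rw [coeff_chromaticSymFun_incGraph, coeff_chromaticSymFun_incGraph, h]

end Chromatic

/-! ### Pairing a symmetric function with the chromatic function -/

section Pairing

variable {P : Type*} [PartialOrder P] [Fintype P] {ψ : symFun →+* MvPolynomial P ℤ}

theorem esymmPart_mem (ν : Ptn) : esymmPart ν ∈ symFun :=
  multiset_prod_mem _ fun f hf => by
    obtain ⟨k, -, rfl⟩ := Multiset.mem_map.1 hf
    exact esymm_mem k

theorem IsPAnalogHom.coe_apply_esymmPart (hψ : IsPAnalogHom P ψ) (ν : Ptn) :
    (ψ ⟨esymmPart ν, esymmPart_mem ν⟩ : MvPowerSeries P ℤ) =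
      (ν.2.parts.map (chainSeries P)).prod := by
  have h : (⟨esymmPart ν, esymmPart_mem ν⟩ : symFun) =
      (ν.2.parts.map fun k => (⟨esymm k, esymm_mem k⟩ : symFun)).prod := by
    refine Subtype.ext ?_
    change esymmPart ν = symFun.subtype _
    rw [map_multiset_prod, Multiset.map_map]
    rfl
  rw [h, map_multiset_prod, Multiset.map_map, ← MvPolynomial.coeToMvPowerSeries.ringHom_apply,
    map_multiset_prod, Multiset.map_map]
  congr 1
  refine Multiset.map_congr rfl fun k _ => ?_
  simp only [Function.comp_apply, MvPolynomial.coeToMvPowerSeries.ringHom_apply]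
  rw [hψ k, coe_elemP]

/-- Both sides are linear in `f`. For `f = e_ν` the left side is the coefficient of `x^ν` in the
chromatic function; expand that in the `e_ν'` and use the symmetry of coefficients. -/
theorem IsPAnalogHom.coeff_uP_apply (hψ : IsPAnalogHom P ψ) {c : Ptn →₀ ℤ}
    (hc : chromaticSymFun (incGraph P) = c.sum fun ν z => z • esymmPart ν) (f : symFun) :
    MvPolynomial.coeff (uP P) (ψ f) =
      c.sum fun ν z => z * MvPowerSeries.coeff (expOf ν) (f : MvPowerSeries ℕ ℤ) := by
  have key : ∀ ν, MvPolynomial.coeff (uP P) (ψ ⟨esymmPart ν, esymmPart_mem ν⟩) =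
      c.sum fun ν' z => z * MvPowerSeries.coeff (expOf ν') (esymmPart ν) := by
    intro ν
    rw [← MvPolynomial.coeff_coe, hψ.coe_apply_esymmPart, ← expType_expOf,
      ← coeff_chromaticSymFun_incGraph, hc, Finsupp.sum, map_sum]
    refine Finset.sum_congr rfl fun ν' _ => ?_
    rw [map_zsmul, smul_eq_mul, coeff_expOf_esymmPart_comm]
  obtain ⟨b, hb, -⟩ := existsUnique_sum_esymmPart f.2
  have hf : f = ∑ ν ∈ b.support, b ν • (⟨esymmPart ν, esymmPart_mem ν⟩ : symFun) := by
    refine Subtype.ext ?_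
    rw [← Subring.coe_subtype, map_sum]
    exact hb
  have hf' : (f : MvPowerSeries ℕ ℤ) = ∑ ν ∈ b.support, b ν • esymmPart ν := hb
  rw [hf', hf, map_sum, MvPolynomial.coeff_sum]
  simp only [map_zsmul, MvPolynomial.coeff_smul, key, Finsupp.sum, map_sum, smul_eq_mul,
    Finset.mul_sum]
  rw [Finset.sum_comm]
  exact Finset.sum_congr rfl fun _ _ => Finset.sum_congr rfl fun _ _ => mul_left_comm _ _ _

end Pairing

/-! ### The cylindric Schur function and its image under `ψ` -/

section CylindricSchur

variable {lam mu : YoungDiagram} {d : ℕ}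

theorem threePlusOneFree_of_linearOrder (Q : Type*) [LinearOrder Q] : ThreePlusOneFree Q := by
  rintro ⟨a, b, c, x, -, -, h, -, -⟩
  exact (le_total x a).elim h.1 h.2

/-- A total order is (3+1)-free, so the signed count applies to `Q = ℕ`. -/
theorem cylSchur_eq_sum (hshape : IsCylindricShape lam mu d) : cylSchur lam mu d =
    ∑ n ∈ cylLengths lam mu, cylCoeff lam mu d n • ∏ j, esymm (n j) := by
  ext m
  simp only [esymm_eq_chainSeries]
  rw [coeff_sum_lengthSign_eq_card (threePlusOneFree_of_linearOrder ℕ) hshape]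
  rfl

theorem cylSchur_mem (hshape : IsCylindricShape lam mu d) : cylSchur lam mu d ∈ symFun := by
  rw [cylSchur_eq_sum hshape]
  exact sum_mem fun n _ => zsmul_mem (prod_mem fun j _ => esymm_mem _) _

/-- The multipliers `cylCoeff` do not depend on the poset, so `ψ` maps the expansion over `ℕ` to the
one over `P`. -/
theorem IsPAnalogHom.coeff_uP_cylSchur {P : Type*} [PartialOrder P] [Fintype P]
    {ψ : symFun →+* MvPolynomial P ℤ} (hψ : IsPAnalogHom P ψ) (hP : ThreePlusOneFree P)
    (hshape : IsCylindricShape lam mu d) :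
    MvPolynomial.coeff (uP P) (ψ ⟨cylSchur lam mu d, cylSchur_mem hshape⟩) =
      Nat.card {T : SkewBox lam mu → P // IsCylindricPTableau d T ∧ IsStandard T} := by
  have h : (⟨cylSchur lam mu d, cylSchur_mem hshape⟩ : symFun) = ∑ n ∈ cylLengths lam mu,
      cylCoeff lam mu d n • ∏ j, (⟨esymm (n j), esymm_mem (n j)⟩ : symFun) := by
    refine Subtype.ext ?_
    rw [← Subring.coe_subtype, map_sum]
    simp only [map_zsmul, map_prod, Subring.coe_subtype]
    exact cylSchur_eq_sum hshape
  have h1 : ((ψ ⟨cylSchur lam mu d, cylSchur_mem hshape⟩ : MvPolynomial P ℤ) :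
      MvPowerSeries P ℤ) =
      ∑ n ∈ cylLengths lam mu, cylCoeff lam mu d n • ∏ j, chainSeries P (n j) := by
    rw [h, ← MvPolynomial.coeToMvPowerSeries.ringHom_apply]
    simp only [map_sum, map_zsmul, map_prod]
    simp only [hψ _, MvPolynomial.coeToMvPowerSeries.ringHom_apply, coe_elemP]
  rw [← MvPolynomial.coeff_coe, h1, coeff_sum_lengthSign_eq_card hP hshape, Nat.cast_inj]
  exact Nat.card_congr (Equiv.subtypeEquivRight fun T =>
    and_congr_right' (sum_single_eq_uP_iff T))

end CylindricSchur

end CylP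

/-! ### The main theorem -/

theorem mainTheorem2 (P : Type*) [PartialOrder P] [Fintype P] (hP : CylP.ThreePlusOneFree P)
    (lam mu : YoungDiagram) (d : ℕ) (hshape : CylP.IsCylindricShape lam mu d) :
    -- the homomorphism, the symmetric function and the two families of coefficients exist
    (∃! ψ : CylP.symFun →+* MvPolynomial P ℤ, CylP.IsPAnalogHom P ψ) ∧
    (∃! a : CylP.Ptn →₀ ℤ, CylP.cylSchur lam mu d = a.sum fun ν z => z • CylP.msymm ν) ∧
    (∃! c : CylP.Ptn →₀ ℤ,
      CylP.chromaticSymFun (CylP.incGraph P) = c.sum fun ν z => z • CylP.esymmPart ν) ∧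
    ∃ hs : CylP.cylSchur lam mu d ∈ CylP.symFun,
      ∀ (ψ : CylP.symFun →+* MvPolynomial P ℤ) (a c : CylP.Ptn →₀ ℤ),
        CylP.IsPAnalogHom P ψ →
        CylP.cylSchur lam mu d = (a.sum fun ν z => z • CylP.msymm ν) →
        CylP.chromaticSymFun (CylP.incGraph P) = (c.sum fun ν z => z • CylP.esymmPart ν) →
        (a.sum fun ν z => z * c ν) =
            MvPolynomial.coeff (CylP.uP P) (ψ ⟨CylP.cylSchur lam mu d, hs⟩) ∧
        MvPolynomial.coeff (CylP.uP P) (ψ ⟨CylP.cylSchur lam mu d, hs⟩) =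
            (Nat.card {T : CylP.SkewBox lam mu → P //
              CylP.IsCylindricPTableau d T ∧ CylP.IsStandard T} : ℤ) ∧
        0 ≤ a.sum fun ν z => z * c ν := by
  classical
  refine ⟨CylP.existsUnique_isPAnalogHom P, CylP.existsUnique_sum_msymm (CylP.cylSchur_mem hshape),
    CylP.existsUnique_sum_esymmPart CylP.chromaticSymFun_incGraph_mem, CylP.cylSchur_mem hshape,
    fun ψ a c hψ ha hc => ?_⟩
  have h1 := hψ.coeff_uP_cylSchur hP hshape
  have h2 : (a.sum fun ν z => z * c ν) =
      MvPolynomial.coeff (CylP.uP P) (ψ ⟨CylP.cylSchur lam mu d, CylP.cylSchur_mem hshape⟩) := by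
    have h3 : ∀ ν, MvPowerSeries.coeff (CylP.expOf ν) (CylP.cylSchur lam mu d) = a ν := by
      intro ν
      rw [ha, CylP.coeff_sum_msymm, CylP.ptnOf_expOf]
    rw [hψ.coeff_uP_apply hc]
    simp only [h3]
    -- One sum runs over the support of `a`, the other over that of `c`; both are extended to the
    -- union.
    rw [Finsupp.sum_of_support_subset a (Finset.subset_union_left (s₂ := c.support)) _ (by simp),
      Finsupp.sum_of_support_subset c (Finset.subset_union_right (s₁ := a.support)) _ (by simp)]
    exact Finset.sum_congr rfl fun ν _ => mul_comm _ _
  refine ⟨h2, h1, ?_⟩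
  rw [h2, h1]
  exact Int.natCast_nonneg _
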